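/- For $m\ge 1$ let $I_2(m)$ be the dihedral group of order $2m$. For $n\ge 0$ let $C_n\cong(\mathbb Z/2)^n\rtimes\mathfrak S_n$ be the symmetry group of the $n$-cube $[-1,1]^n\subset\mathbb R^n$, and let $\mathfrak S_n$ be the symmetric group on $n$ letters (for $n\ge1$ it is isomorphic to the reflection group $A_{n-1}$). Let $p$ be an odd prime, and let $W_n$ be $C_n$ or $\mathfrak S_n$. Put $\tau=2$ if $W_n=C_n$ and $\tau=1$ if $W_n=\mathfrak S_n$. (1) The number of group homomorphisms $I_2(p)\to W_n$ is $$|\mathrm{Hom}(I_2(p),W_n)|=\sum_{k=0}^{\lfloor n/p\rfloor}\ \sum_{l=0}^{\lfloor k/2\rfloor}\ \sum_{m=0}^{\lfloor (n-kp)/2\rfloor}\frac{|W_n|}{(k-2l)!\;l!\;p^l\;2^{\tau(l+m)}\;(n-kp-2m)!\;m!}.$$ (2) If $p\le n$, then the number of subgroups of $W_n$ isomorphic to $I_2(p)$ is $$\frac{|W_n|}{p(p-1)}\sum_{k=1}^{\lfloor n/p\rfloor}\ \sum_{l=0}^{\lfloor k/2\rfloor}\ \sum_{m=0}^{\lfloor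 (n-kp)/2\rfloor}\frac{1}{(k-2l)!\;l!\;p^l\;2^{\tau(l+m)}\;(n-kp-2m)!\;m!}.$$ -/

import Mathlib

open scoped Nat

/-- The `n`-cube `[-1, 1]ⁿ` in Euclidean space `ℝⁿ`. -/
def cube (n : ℕ) : Set (EuclideanSpace ℝ (Fin n)) :=
  {x | ∀ i, |x i| ≤ 1}

/-- The group `C_n`: the symmetry group of the `n`-cube, i.e. the group of all linear isometries
of `ℝⁿ` which map the cube onto itself. (A symmetry of the cube fixes its centre, the origin,
so it is linear.) -/
def symmetryGroupCube (n : ℕ) :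
    Subgroup (EuclideanSpace ℝ (Fin n) ≃ₗᵢ[ℝ] EuclideanSpace ℝ (Fin n)) where
  carrier := {w | w '' cube n = cube n}
  one_mem' := by
    change (fun x => x) '' cube n = cube n
    exact Set.image_id' _
  mul_mem' := by
    intro a b ha hb
    change (fun x => a (b x)) '' cube n = cube n
    have h : (fun x => a (b x)) '' cube n = a '' (b '' cube n) := by
      rw [Set.image_image]
    rw [h, hb, ha]
  inv_mem' := by
    intro a ha
    change a.symm '' cube n = cube n
    have ha' : a '' cube n = cube n := ha
    conv_lhs => rw [← ha']
    rw [Set.image_image]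
    simp

/-- The denominator
`(k - 2l)! · l! · p^l · 2^{τ(l+m)} · (n - kp - 2m)! · m!`.
It is only used for `kp ≤ n`, `2l ≤ k` and `2m ≤ n - kp`, so no subtraction truncates. -/
def denom (p n τ k l m : ℕ) : ℚ :=
  ((k - 2 * l)! * l ! * p ^ l * 2 ^ (τ * (l + m)) * (n - k * p - 2 * m)! * m ! : ℕ)

/-! Both groups are centralizers of a free action of a group `A` of exponent dividing 2 and order
`τ`: the sign group acting on the `2n` vectors `± e_i` for the cube, the trivial group acting on `n`
letters for the symmetric group. A homomorphism from `D_p` into such a centralizer is an action of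
`D_p × A` on the `nτ` points extending the given action of `A`. All free actions of `A` on these
points are conjugate, so the number of homomorphisms divided by `|W_n|` equals the number of actions
of `D_p × A` with `A` free divided by `(nτ)!` (`card_dihedralHom_centralizer`).

Sorting pairs (action, point) by the stabilizer of the point gives a recurrence with one term for
each admissible stabilizer (`numActions_recurrence`). Here these are the subgroups meeting `A`
trivially, that is, graphs of homomorphisms from subgroups of `D_p` to `A`; since `p` is odd there
are four families, of index `τ`, `2τ`, `pτ`, `2pτ`. The normalized numbers thus satisfy the
recurrence of the coefficients of `exp (x + x²/(2τ) + xᵖ + x²ᵖ/(2τp))`, whose expansion is the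
triple sum.

For subgroups, a homomorphism is injective exactly when it does not kill the rotations. The same
count with the rotations acting trivially leaves only the `k = 0` terms, so the injective
homomorphisms are counted by `k ≥ 1`; division by `|Aut D_p| = p(p-1)` gives the subgroups. -/

section ActionCounting

/-! ### Counting actions of a finite group by point stabilizers. -/

variable {Γ : Type*} [Group Γ] {X Y Z : Type*}

/-- The stabilizer of a point under an action given as a homomorphism to permutations. -/
def pointStabilizer (f : Γ →* Equiv.Perm X) (x : X) : Subgroup Γ :=
  (MulAction.stabilizer (Equiv.Perm X) x).comap f

theorem mem_pointStabilizer {f : Γ →* Equiv.Perm X} {x : X} {g : Γ} :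
    g ∈ pointStabilizer f x ↔ f g x = x := Iff.rfl

/-- Actions of `Γ` on `X` all of whose point stabilizers satisfy `P`. -/
def ActionWith (P : Subgroup Γ → Prop) (X : Type*) : Type _ :=
  {f : Γ →* Equiv.Perm X // ∀ x, P (pointStabilizer f x)}

/-- The number of actions of `Γ` on `n` points all of whose stabilizers satisfy `P`. -/
noncomputable def numActions (P : Subgroup Γ → Prop) (n : ℕ) : ℕ :=
  Nat.card (ActionWith P (Fin n))

instance finite_perm_hom [Finite Γ] [Finite X] : Finite (Γ →* Equiv.Perm X) :=
  Finite.of_injective _ DFunLike.coe_injective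

instance finite_actionWith [Finite Γ] [Finite X] (P : Subgroup Γ → Prop) :
    Finite (ActionWith P X) := by
  unfold ActionWith; infer_instance

theorem pointStabilizer_permCongr (e : X ≃ Y) (f : Γ →* Equiv.Perm X) (y : Y) :
    pointStabilizer ((e.permCongrHom : Equiv.Perm X →* Equiv.Perm Y).comp f) y =
      pointStabilizer f (e.symm y) := by
  ext g
  simp only [mem_pointStabilizer, MonoidHom.comp_apply]
  change e (f g (e.symm y)) = y ↔ _
  rw [Equiv.eq_symm_apply]

/-- Transport of actions along a bijection. -/
def ActionWith.congr (P : Subgroup Γ → Prop) (e : X ≃ Y) : ActionWith P X ≃ ActionWith P Y where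
  toFun f := ⟨(e.permCongrHom : Equiv.Perm X →* Equiv.Perm Y).comp f.1, fun y => by
    rw [pointStabilizer_permCongr]; exact f.2 _⟩
  invFun f := ⟨(e.symm.permCongrHom : Equiv.Perm Y →* Equiv.Perm X).comp f.1, fun y => by
    rw [pointStabilizer_permCongr]; exact f.2 _⟩
  left_inv f := by
    apply Subtype.ext; ext g x
    change e.symm (e (f.1 g (e.symm (e x)))) = _
    simp
  right_inv f := by
    apply Subtype.ext; ext g x
    change e (e.symm (f.1 g (e (e.symm x)))) = _
    simp

theorem ActionWith.congr_apply (P : Subgroup Γ → Prop) (e : X ≃ Y) (f : ActionWith P X) (g : Γ)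
    (y : Y) : (ActionWith.congr P e f).1 g y = e (f.1 g (e.symm y)) := rfl

theorem card_actionWith [Finite X] (P : Subgroup Γ → Prop) :
    Nat.card (ActionWith P X) = numActions P (Nat.card X) :=
  Nat.card_congr (ActionWith.congr P (Finite.equivFin X))

/-- Once `Y` is an invariant subset with prescribed action, its complement `Z` is invariant too, and
the action on `Z` is unconstrained by `Y`. -/
theorem card_actionWith_sum_extending {P : Subgroup Γ → Prop} [MulAction Γ Y]
    (hY : ∀ y : Y, P (MulAction.stabilizer Γ y)) :
    Nat.card {f : ActionWith P (Y ⊕ Z) // ∀ g (y : Y), f.1 g (Sum.inl y) = Sum.inl (g • y)} =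
      Nat.card (ActionWith P Z) := by
  symm
  let F : ActionWith P Z →
      {f : ActionWith P (Y ⊕ Z) // ∀ g (y : Y), f.1 g (Sum.inl y) = Sum.inl (g • y)} := fun h =>
    ⟨⟨(Equiv.Perm.sumCongrHom Y Z).comp ((MulAction.toPermHom Γ Y).prod h.1), by
      rintro (y | z)
      · convert hY y using 1
        ext g
        simp [mem_pointStabilizer]
      · convert h.2 z using 1
        ext g
        simp [mem_pointStabilizer]⟩, by intro g y; simp⟩
  apply Nat.card_congr (Equiv.ofBijective F ⟨?_, ?_⟩)
  · intro h h' hh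
    apply Subtype.ext
    ext g z
    have := congrArg (fun f => f.1.1 g (Sum.inr z)) hh
    simpa [F] using this
  · rintro ⟨f, hf⟩
    have key : ∀ g z, ∃ z', f.1 g (Sum.inr z) = Sum.inr z' := by
      intro g z
      rcases hz : f.1 g (Sum.inr z) with y | z'
      · exfalso
        have h1 : f.1 g⁻¹ (f.1 g (Sum.inr z)) = Sum.inr z := by
          rw [← Equiv.Perm.mul_apply, ← map_mul]; simp
        rw [hz, hf] at h1
        cases h1
      · exact ⟨z', rfl⟩
    choose h hh using key
    have hmul : ∀ g g' z, h (g * g') z = h g (h g' z) := by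
      intro g g' z
      apply Sum.inr_injective (α := Y)
      rw [← hh, ← hh, ← hh, map_mul, Equiv.Perm.mul_apply]
    have hone : ∀ z, h 1 z = z := by
      intro z
      apply Sum.inr_injective (α := Y)
      rw [← hh]; simp
    let h' : Γ →* Equiv.Perm Z :=
      { toFun := fun g => ⟨h g, h g⁻¹, fun z => by rw [← hmul]; simp [hone],
          fun z => by rw [← hmul]; simp [hone]⟩
        map_one' := by ext z; exact hone z
        map_mul' := by intro a b; ext z; exact hmul a b z }
    refine ⟨⟨h', fun z => ?_⟩, ?_⟩
    · convert f.2 (Sum.inr z) using 1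
      ext g
      rw [mem_pointStabilizer, mem_pointStabilizer, hh]
      simp [h']
    · apply Subtype.ext; apply Subtype.ext; ext g x : 2
      rcases x with y | z
      · change Sum.inl (g • y) = _
        rw [hf]
      · change Sum.inr (h g z) = _
        rw [hh]

theorem card_actionWith_compatible [Finite Γ] [Finite X] {P : Subgroup Γ → Prop}
    (hconj : ∀ K (g : Γ), P K → P (K.map (MulAut.conj g).toMonoidHom)) {K : Subgroup Γ} (hK : P K)
    (e : Γ ⧸ K ↪ X) :
    Nat.card {f : ActionWith P X // ∀ g y, f.1 g (e y) = e (g • y)} =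
      numActions P (Nat.card X - K.index) := by
  classical
  -- Stabilizers of points of `Γ ⧸ K` are the conjugates of `K`; this is where `hconj` is needed.
  have hY : ∀ y : Γ ⧸ K, P (MulAction.stabilizer Γ y) := by
    intro y
    obtain ⟨g, rfl⟩ := QuotientGroup.mk_surjective y
    have : (g : Γ ⧸ K) = g • ((1 : Γ) : Γ ⧸ K) := by
      rw [MulAction.Quotient.smul_coe]; simp
    rw [this, MulAction.stabilizer_smul_eq_stabilizer_map_conj, MulAction.stabilizer_quotient]
    exact hconj K g hK
  let Z := ↥(Set.range e)ᶜ
  let E : X ≃ (Γ ⧸ K) ⊕ Z :=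
    (Equiv.Set.sumCompl (Set.range e)).symm.trans
      (Equiv.sumCongr (Equiv.ofInjective e e.injective).symm (Equiv.refl _))
  have hE' : ∀ y, E.symm (Sum.inl y) = e y := fun y => rfl
  have hE : ∀ y, E (e y) = Sum.inl y := fun y => by rw [← hE', Equiv.apply_symm_apply]
  have hcard : Nat.card Z = Nat.card X - K.index := by
    have := Nat.card_congr E
    rw [Nat.card_sum] at this
    rw [this, Subgroup.index]; simp
  rw [← hcard, ← card_actionWith, ← card_actionWith_sum_extending (Z := Z) hY]
  refine Nat.card_congr ((ActionWith.congr P E).subtypeEquiv fun f => ?_)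
  refine forall_congr' fun g => forall_congr' fun y => ?_
  rw [ActionWith.congr_apply, hE', ← hE, E.injective.eq_iff]

/-- A point with stabilizer exactly `K` is the same as an equivariant embedding of `Γ ⧸ K`, by
taking the image of the trivial coset. The falling factorial counts the embeddings, and the other
factor the actions off the chosen orbit. -/
theorem card_pointed_actionWith [Finite Γ] [Finite X] {P : Subgroup Γ → Prop}
    (hconj : ∀ K (g : Γ), P K → P (K.map (MulAut.conj g).toMonoidHom)) {K : Subgroup Γ} (hK : P K) :
    Nat.card {q : ActionWith P X × X // pointStabilizer q.1.1 q.2 = K} =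
      (Nat.card X).descFactorial K.index * numActions P (Nat.card X - K.index) := by
  classical
  let T := {q : (Γ ⧸ K ↪ X) × ActionWith P X // ∀ g y, q.2.1 g (q.1 y) = q.1 (g • y)}
  have h1 : Nat.card {q : ActionWith P X × X // pointStabilizer q.1.1 q.2 = K} = Nat.card T := by
    symm
    let F : T → {q : ActionWith P X × X // pointStabilizer q.1.1 q.2 = K} := fun q =>
      ⟨(q.1.2, q.1.1 ((1 : Γ) : Γ ⧸ K)), by
        ext g
        rw [mem_pointStabilizer, q.2, q.1.1.injective.eq_iff, MulAction.Quotient.smul_coe,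
          eq_comm, QuotientGroup.eq]
        simp⟩
    refine Nat.card_congr (Equiv.ofBijective F ⟨?_, ?_⟩)
    · rintro ⟨⟨e, f⟩, h⟩ ⟨⟨e', f'⟩, h'⟩ hh
      simp only [F, Subtype.mk.injEq, Prod.mk.injEq] at hh
      obtain ⟨rfl, h1⟩ := hh
      have : e = e' := by
        ext y
        obtain ⟨g, rfl⟩ := QuotientGroup.mk_surjective y
        have : (g : Γ ⧸ K) = g • ((1 : Γ) : Γ ⧸ K) := by
          rw [MulAction.Quotient.smul_coe]; simp
        have a1 := h g ((1 : Γ) : Γ ⧸ K)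
        have a2 := h' g ((1 : Γ) : Γ ⧸ K)
        simp only at a1 a2
        rw [this, ← a1, ← a2, h1]
      subst this
      rfl
    · rintro ⟨⟨f, x⟩, h⟩
      simp only at h
      have hrel : ∀ a b : Γ, (a : Γ ⧸ K) = b ↔ f.1 a x = f.1 b x := by
        intro a b
        rw [QuotientGroup.eq, ← h, mem_pointStabilizer, map_mul, Equiv.Perm.mul_apply, map_inv,
          Equiv.Perm.inv_eq_iff_eq, eq_comm]
      let e : Γ ⧸ K ↪ X :=
        ⟨Quotient.lift (fun a => f.1 a x) (fun a b hab => (hrel a b).1 (Quotient.sound hab)), by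
          intro a b hab
          obtain ⟨a, rfl⟩ := QuotientGroup.mk_surjective a
          obtain ⟨b, rfl⟩ := QuotientGroup.mk_surjective b
          exact (hrel a b).2 hab⟩
      have he : ∀ a : Γ, e (a : Γ ⧸ K) = f.1 a x := fun a => rfl
      refine ⟨⟨(e, f), ?_⟩, ?_⟩
      · intro g y
        obtain ⟨a, rfl⟩ := QuotientGroup.mk_surjective y
        simp only [MulAction.Quotient.smul_coe, he, smul_eq_mul, map_mul, Equiv.Perm.mul_apply]
      · apply Subtype.ext
        simp [F, he]
  rw [h1, Nat.card_congr (Equiv.subtypeProdEquivSigmaSubtype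
    (fun (e : Γ ⧸ K ↪ X) (f : ActionWith P X) => ∀ g y, f.1 g (e y) = e (g • y)))]
  have := Fintype.ofFinite X
  have := Fintype.ofFinite (Γ ⧸ K)
  rw [Nat.card_sigma, Finset.sum_congr rfl fun e _ => card_actionWith_compatible hconj hK e]
  simp only [Finset.sum_const, Finset.card_univ, smul_eq_mul]
  rw [Fintype.card_embedding_eq, Subgroup.index, Nat.card_eq_fintype_card,
    Nat.card_eq_fintype_card]

open Classical in
theorem numActions_recurrence [Finite Γ] [Fintype (Subgroup Γ)] {P : Subgroup Γ → Prop}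
    (hconj : ∀ K (g : Γ), P K → P (K.map (MulAut.conj g).toMonoidHom)) (m : ℕ) :
    m * numActions P m = ∑ K : Subgroup Γ with P K,
      m.descFactorial K.index * numActions P (m - K.index) := by
  have : Fintype (ActionWith P (Fin m)) := Fintype.ofFinite _
  have h : Nat.card (ActionWith P (Fin m) × Fin m) = m * numActions P m := by
    rw [Nat.card_prod, numActions, Nat.card_fin, mul_comm]
  rw [← h, Nat.card_eq_fintype_card, ← Finset.card_univ,
    Finset.card_eq_sum_card_fiberwise (f := fun q => pointStabilizer q.1.1 q.2)
      (t := Finset.univ.filter P) (fun q _ => by simpa using q.1.2 q.2)]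
  refine Finset.sum_congr rfl fun K hK => ?_
  have := card_pointed_actionWith (X := Fin m) hconj (by simpa using hK : P K)
  rw [Nat.card_fin] at this
  rw [← this, Nat.card_eq_fintype_card, Fintype.card_subtype]

open Classical in
/-- The recurrence for actions, normalized by the order of the symmetric group. -/
theorem numActions_div_factorial_recurrence [Finite Γ] [Fintype (Subgroup Γ)]
    {P : Subgroup Γ → Prop}
    (hconj : ∀ K (g : Γ), P K → P (K.map (MulAut.conj g).toMonoidHom)) (m : ℕ) :
    (m : ℚ) * ((numActions P m : ℚ) / m !) = ∑ K : Subgroup Γ with P K,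
      if K.index ≤ m then (numActions P (m - K.index) : ℚ) / (m - K.index)! else 0 := by
  have h := numActions_recurrence hconj m
  have h' : (m : ℚ) * numActions P m = ∑ K : Subgroup Γ with P K,
      (m.descFactorial K.index : ℚ) * numActions P (m - K.index) := by exact_mod_cast h
  rw [← mul_div_assoc, h', Finset.sum_div]
  refine Finset.sum_congr rfl fun K _ => ?_
  split_ifs with hd
  · rw [← Nat.factorial_mul_descFactorial hd]
    push_cast
    have h1 : ((m - K.index)! : ℚ) ≠ 0 := by positivity
    have h2 : (m.descFactorial K.index : ℚ) ≠ 0 := by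
      exact_mod_cast (Nat.descFactorial_pos.2 hd).ne'
    field_simp
  · rw [Nat.descFactorial_of_lt (by omega)]; simp

end ActionCounting

/-- The sequence `u` delayed by `d` steps. -/
def shift (u : ℕ → ℚ) (d n : ℕ) : ℚ :=
  if d ≤ n then u (n - d) else 0

/-! ### Admissible stabilizers in `D_p × A` and the resulting recurrence. -/

section DihedralSubgroups

open DihedralGroup

variable {p : ℕ} {A : Type*} [Group A]

/-- The subgroups of `D_p × A` meeting `A` trivially and, if `b` holds, containing the rotations. -/
def IsPartialGraph (b : Bool) (K : Subgroup (DihedralGroup p × A)) : Prop :=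
  (∀ a : A, ((1 : DihedralGroup p), a) ∈ K → a = 1) ∧ (b = true → (r 1, 1) ∈ K)

/-- A group of exponent dividing 2 is abelian, so `A` is central in the product, and the rotations
form a normal subgroup. -/
theorem isPartialGraph_conj (hA : ∀ a : A, a * a = 1) (b : Bool)
    (K : Subgroup (DihedralGroup p × A)) (g : DihedralGroup p × A) (hK : IsPartialGraph b K) :
    IsPartialGraph b (K.map (MulAut.conj g).toMonoidHom) := by
  have key : ∀ x, x ∈ K.map (MulAut.conj g).toMonoidHom ↔ g⁻¹ * x * g ∈ K := by
    intro x
    constructor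
    · rintro ⟨y, hy, rfl⟩
      simpa [MulAut.conj_apply, mul_assoc] using hy
    · intro h
      exact ⟨_, h, by simp [MulAut.conj_apply, mul_assoc]⟩
  have hcomm : ∀ a b : A, a * b = b * a := by
    intro a b
    have h := hA (a * b)
    have ha := mul_eq_one_iff_eq_inv.1 (hA a)
    have hb := mul_eq_one_iff_eq_inv.1 (hA b)
    rw [mul_eq_one_iff_eq_inv, mul_inv_rev, ← ha, ← hb] at h
    exact h
  obtain ⟨d, c⟩ := g
  constructor
  · intro a ha
    rw [key] at ha
    apply hK.1
    convert ha using 1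
    simp [mul_assoc, hcomm a c]
  · intro hb
    rw [key]
    have hr := hK.2 hb
    rcases d with i | i
    · simpa using hr
    · convert K.inv_mem hr using 1
      simp

theorem sr_ne_one (i : ZMod p) : sr i ≠ 1 := by
  rw [one_def]; exact fun h => by injection h

theorem r_one_ne_one [Fact p.Prime] : r (1 : ZMod p) ≠ 1 := by
  rw [one_def]; exact fun h => by injection h with h; exact one_ne_zero h

theorem mem_zpowers_of_mul_self {G : Type*} [Group G] {x y : G} (hx : x * x = 1) :
    y ∈ Subgroup.zpowers x ↔ y = 1 ∨ y = x := by
  constructor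
  · rintro ⟨k, rfl⟩
    rcases Int.even_or_odd' k with ⟨l, rfl | rfl⟩
    · left; simp [zpow_mul, zpow_ofNat, pow_two, hx]
    · right; simp [zpow_add, zpow_mul, zpow_ofNat, pow_two, hx]
  · rintro (rfl | rfl)
    · exact one_mem _
    · exact Subgroup.mem_zpowers _

/-- The homomorphism from the dihedral group which kills the rotations and maps the reflections to
the involution `a`. -/
def reflectionHom (p : ℕ) (a : A) (ha : a * a = 1) : DihedralGroup p →* A where
  toFun
    | r _ => 1
    | sr _ => a
  map_one' := rfl
  map_mul' := by
    rintro (i | i) (j | j)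
    · change (1 : A) = 1 * 1
      simp
    · change a = 1 * a
      simp
    · change a = a * 1
      simp
    · change 1 = a * a
      exact ha.symm

/-- The graph of `reflectionHom p a`. -/
def reflectionGraph (p : ℕ) (a : A) (ha : a * a = 1) : Subgroup (DihedralGroup p × A) :=
  ((MonoidHom.id _).prod (reflectionHom p a ha)).range

theorem mem_reflectionGraph {a : A} {ha : a * a = 1} {x : DihedralGroup p} {c : A} :
    (x, c) ∈ reflectionGraph p a ha ↔ reflectionHom p a ha x = c := by
  constructor
  · rintro ⟨y, hy⟩
    simp only [MonoidHom.prod_apply, MonoidHom.id_apply, Prod.mk.injEq] at hy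
    rw [← hy.1, hy.2]
  · rintro rfl
    exact ⟨x, rfl⟩

theorem r_mem_reflectionGraph {a : A} {ha : a * a = 1} {i : ZMod p} {c : A} :
    (r i, c) ∈ reflectionGraph p a ha ↔ c = 1 := by
  rw [mem_reflectionGraph, eq_comm]; rfl

theorem sr_mem_reflectionGraph {a : A} {ha : a * a = 1} {i : ZMod p} {c : A} :
    (sr i, c) ∈ reflectionGraph p a ha ↔ c = a := by
  rw [mem_reflectionGraph, eq_comm]; rfl

/-- The `p`-th power of `(r i, c)` is `(1, c)`, because `p` is odd and `c` squares to 1. -/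
theorem r_mem_iff_of_isPartialGraph (hodd : Odd p) (hA : ∀ a : A, a * a = 1) {b : Bool}
    {K : Subgroup (DihedralGroup p × A)} (hK : IsPartialGraph b K) {i : ZMod p} {c : A}
    (h : (r i, c) ∈ K) : c = 1 := by
  apply hK.1
  have h1 := K.pow_mem h p
  obtain ⟨k, hk⟩ := hodd
  have hc : c ^ p = c := by
    rw [hk, pow_succ, pow_mul, pow_two, hA]; simp
  rw [Prod.pow_mk, hc, r_pow] at h1
  simpa [← r_zero] using h1

theorem r_one_mem_of_r_mem [Fact p.Prime] {K : Subgroup (DihedralGroup p × A)} {i : ZMod p}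
    (hi : i ≠ 0) (h : (r i, (1 : A)) ∈ K) : (r 1, (1 : A)) ∈ K := by
  have h1 := K.pow_mem h (i⁻¹).val
  rw [Prod.pow_mk, r_pow, one_pow, ZMod.natCast_val, ZMod.cast_id, mul_inv_cancel₀ hi] at h1
  exact h1

theorem r_mem_of_r_one_mem [NeZero p] {K : Subgroup (DihedralGroup p × A)}
    (h : (r 1, (1 : A)) ∈ K) (i : ZMod p) : (r i, (1 : A)) ∈ K := by
  have h1 := K.pow_mem h i.val
  rw [Prod.pow_mk, r_pow, one_pow, ZMod.natCast_val, ZMod.cast_id, one_mul] at h1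
  exact h1

theorem eq_of_sr_mem_of_isPartialGraph (hodd : Odd p) (hA : ∀ a : A, a * a = 1) {b : Bool}
    {K : Subgroup (DihedralGroup p × A)} (hK : IsPartialGraph b K) {i j : ZMod p} {c d : A}
    (h : (sr i, c) ∈ K) (h' : (sr j, d) ∈ K) : c = d ∧ (r (j - i), (1 : A)) ∈ K := by
  have h1 := K.mul_mem h h'
  rw [Prod.mk_mul_mk, sr_mul_sr] at h1
  have h2 := r_mem_iff_of_isPartialGraph hodd hA hK h1
  refine ⟨?_, by rwa [h2] at h1⟩
  rw [mul_eq_one_iff_eq_inv.1 h2, ← mul_eq_one_iff_eq_inv.1 (hA d)]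

theorem mem_zpowers_r [NeZero p] {x : DihedralGroup p} {c : A} :
    (x, c) ∈ Subgroup.zpowers (r (1 : ZMod p), (1 : A)) ↔ (∃ i, x = r i) ∧ c = 1 := by
  constructor
  · rintro ⟨k, hk⟩
    simp only [Prod.pow_mk, r_zpow, one_zpow, Prod.mk.injEq] at hk
    exact ⟨⟨_, hk.1.symm⟩, hk.2.symm⟩
  · rintro ⟨⟨i, rfl⟩, rfl⟩
    exact r_mem_of_r_one_mem (Subgroup.mem_zpowers _) i

/-- The projection of `K` to `D_p` is either the rotation group or everything. In the second case
all reflections in `K` carry the same element of `A`, which determines `K`. -/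
theorem isPartialGraph_r_mem_iff [NeZero p] (hodd : Odd p) (hA : ∀ a : A, a * a = 1)
    (K : Subgroup (DihedralGroup p × A)) :
    IsPartialGraph true K ↔
      K = Subgroup.zpowers (r 1, 1) ∨ ∃ a, reflectionGraph p a (hA a) = K := by
  constructor
  · intro hK
    have hr := r_mem_of_r_one_mem (hK.2 rfl)
    by_cases hs : ∃ i a, (sr i, a) ∈ K
    · right
      obtain ⟨i, a, ha⟩ := hs
      refine ⟨a, ?_⟩
      ext ⟨j | j, c⟩
      · rw [r_mem_reflectionGraph]
        exact ⟨fun h => h ▸ hr j, fun h => r_mem_iff_of_isPartialGraph hodd hA hK h⟩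
      · rw [sr_mem_reflectionGraph]
        refine ⟨fun h => ?_, fun h => (eq_of_sr_mem_of_isPartialGraph hodd hA hK h ha).1⟩
        have := K.mul_mem ha (hr (j - i))
        rw [Prod.mk_mul_mk, sr_mul_r] at this
        simpa [h] using this
    · left
      ext ⟨j | j, c⟩
      · rw [mem_zpowers_r]
        refine ⟨fun h => ⟨⟨j, rfl⟩, r_mem_iff_of_isPartialGraph hodd hA hK h⟩, fun h => h.2 ▸ hr j⟩
      · rw [mem_zpowers_r]
        exact ⟨fun h => absurd ⟨j, c, h⟩ hs, fun h => by simp at h⟩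
  · rintro (rfl | ⟨a, rfl⟩)
    · exact ⟨fun a ha => (mem_zpowers_r.1 ha).2, fun _ => Subgroup.mem_zpowers _⟩
    · refine ⟨fun c hc => ?_, fun _ => r_mem_reflectionGraph.2 rfl⟩
      rw [one_def] at hc
      exact r_mem_reflectionGraph.1 hc

theorem sr_mul_self_prod (hA : ∀ a : A, a * a = 1) (i : ZMod p) (a : A) :
    (sr i, a) * (sr i, a) = 1 := by
  rw [Prod.mk_mul_mk, sr_mul_self, hA]; rfl

/-- As `p` is prime, any nontrivial rotation generates all of them, so `K` contains none; then two
reflections in `K` must coincide, since their product is a rotation. -/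
theorem isPartialGraph_r_notMem_iff [Fact p.Prime] (hodd : Odd p) (hA : ∀ a : A, a * a = 1)
    (K : Subgroup (DihedralGroup p × A)) :
    IsPartialGraph false K ∧ (r 1, 1) ∉ K ↔
      K = ⊥ ∨ ∃ q : ZMod p × A, Subgroup.zpowers (sr q.1, q.2) = K := by
  constructor
  · rintro ⟨hK, hr⟩
    have hr' : ∀ i c, (r i, c) ∈ K → i = 0 ∧ c = 1 := by
      intro i c h
      have hc := r_mem_iff_of_isPartialGraph hodd hA hK h
      subst hc
      exact ⟨by_contra fun hi => hr (r_one_mem_of_r_mem hi h), rfl⟩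
    by_cases hs : ∃ i a, (sr i, a) ∈ K
    · right
      obtain ⟨i, a, ha⟩ := hs
      refine ⟨(i, a), ?_⟩
      ext ⟨j | j, c⟩
      · rw [mem_zpowers_of_mul_self (sr_mul_self_prod hA i a)]
        constructor
        · rintro (h | h)
          · rw [h]; exact one_mem _
          · simp at h
        · intro h
          obtain ⟨rfl, rfl⟩ := hr' j c h
          left; rfl
      · rw [mem_zpowers_of_mul_self (sr_mul_self_prod hA i a)]
        constructor
        · rintro (h | h)
          · rw [h]; exact one_mem _
          · rw [h]; exact ha
        · intro h
          obtain ⟨rfl, h2⟩ := eq_of_sr_mem_of_isPartialGraph hodd hA hK h ha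
          right
          rw [sub_eq_zero.1 (hr' _ _ h2).1]
    · left
      rw [Subgroup.eq_bot_iff_forall]
      rintro ⟨j | j, c⟩ h
      · obtain ⟨rfl, rfl⟩ := hr' j c h
        rfl
      · exact absurd ⟨j, c, h⟩ hs
  · have hone : (r (1 : ZMod p), (1 : A)) ≠ 1 := by
      exact fun h => r_one_ne_one (congrArg Prod.fst h)
    rintro (rfl | ⟨⟨i, a⟩, rfl⟩)
    · refine ⟨⟨fun a ha => ?_, by simp⟩, ?_⟩
      · exact (Prod.ext_iff.1 (Subgroup.mem_bot.1 ha)).2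
      · rwa [Subgroup.mem_bot]
    · simp only
      refine ⟨⟨fun c hc => ?_, by simp⟩, fun h => ?_⟩
      · rw [mem_zpowers_of_mul_self (sr_mul_self_prod hA i a)] at hc
        rcases hc with h | h
        · exact (Prod.ext_iff.1 h).2
        · exact absurd (congrArg Prod.fst h).symm (sr_ne_one i)
      · rw [mem_zpowers_of_mul_self (sr_mul_self_prod hA i a)] at h
        rcases h with h | h
        · exact hone h
        · simp at h

theorem index_eq_of_card [NeZero p] [Finite A] {K : Subgroup (DihedralGroup p × A)} {c d : ℕ}
    (hc : Nat.card K = c) (hd : c * d = 2 * p * Nat.card A) : K.index = d := by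
  have h := K.card_mul_index
  rw [Nat.card_prod, DihedralGroup.nat_card, ← hd, hc] at h
  refine Nat.eq_of_mul_eq_mul_left ?_ h
  rw [← hc]; exact Nat.card_pos

theorem index_reflectionGraph [NeZero p] [Finite A] (a : A) (ha : a * a = 1) :
    (reflectionGraph p a ha).index = Nat.card A := by
  refine index_eq_of_card (c := 2 * p) ?_ rfl
  rw [← DihedralGroup.nat_card]
  refine (Nat.card_congr (MonoidHom.ofInjective (f := (MonoidHom.id _).prod (reflectionHom p a ha))
    ?_).toEquiv).symm
  intro x y h
  exact congrArg Prod.fst h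

theorem index_zpowers_r [NeZero p] [Finite A] :
    (Subgroup.zpowers (r (1 : ZMod p), (1 : A))).index = 2 * Nat.card A := by
  refine index_eq_of_card (c := p) ?_ (by ring)
  rw [Nat.card_zpowers, Prod.orderOf_mk, orderOf_r_one, orderOf_one, Nat.lcm_one_right]

theorem index_zpowers_sr [NeZero p] [Finite A] (hA : ∀ a : A, a * a = 1) (i : ZMod p) (a : A) :
    (Subgroup.zpowers (sr i, a)).index = p * Nat.card A := by
  refine index_eq_of_card (c := 2) ?_ (by ring)
  rw [Nat.card_zpowers]
  refine orderOf_eq_prime (by rw [pow_two, sr_mul_self_prod hA]) ?_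
  exact fun h => sr_ne_one i (congrArg Prod.fst h)

theorem index_bot_dihedral [NeZero p] [Finite A] :
    (⊥ : Subgroup (DihedralGroup p × A)).index = 2 * p * Nat.card A :=
  index_eq_of_card (c := 1) (by simp) (by ring)

open Classical in
theorem sum_isPartialGraph_true [NeZero p] [Finite A] [Fintype (Subgroup (DihedralGroup p × A))]
    (hodd : Odd p) (hA : ∀ a : A, a * a = 1) (ψ : ℕ → ℚ) :
    ∑ K : Subgroup (DihedralGroup p × A) with IsPartialGraph true K, ψ K.index =
      Nat.card A * ψ (Nat.card A) + ψ (2 * Nat.card A) := by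
  have := Fintype.ofFinite A
  have h : Finset.univ.filter (IsPartialGraph (p := p) (A := A) true) =
      insert (Subgroup.zpowers (r 1, 1))
        (Finset.univ.image fun a => reflectionGraph p a (hA a)) := by
    ext K
    simp [isPartialGraph_r_mem_iff hodd hA]
  have hinj : Function.Injective fun a => reflectionGraph p a (hA a) := by
    intro a b hab
    have h1 : (sr 0, a) ∈ reflectionGraph p a (hA a) := sr_mem_reflectionGraph.2 rfl
    simp only at hab
    rw [hab] at h1
    exact sr_mem_reflectionGraph.1 h1
  rw [h, Finset.sum_insert, Finset.sum_image fun a _ b _ h => hinj h, index_zpowers_r]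
  · simp only [index_reflectionGraph, Finset.sum_const, Finset.card_univ, nsmul_eq_mul,
      Nat.card_eq_fintype_card]
    ring
  · simp only [Finset.mem_image, Finset.mem_univ, true_and, not_exists]
    intro a ha
    have h1 : (sr 0, a) ∈ reflectionGraph p a (hA a) := sr_mem_reflectionGraph.2 rfl
    rw [ha, mem_zpowers_r] at h1
    simp at h1

open Classical in
theorem sum_isPartialGraph_false [Fact p.Prime] [Finite A]
    [Fintype (Subgroup (DihedralGroup p × A))]
    (hodd : Odd p) (hA : ∀ a : A, a * a = 1) (ψ : ℕ → ℚ) :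
    ∑ K : Subgroup (DihedralGroup p × A) with IsPartialGraph false K, ψ K.index =
      Nat.card A * ψ (Nat.card A) + ψ (2 * Nat.card A) +
        (Nat.card A * p * ψ (p * Nat.card A) + ψ (2 * p * Nat.card A)) := by
  have := Fintype.ofFinite A
  rw [← Finset.sum_filter_add_sum_filter_not _
    (fun K : Subgroup (DihedralGroup p × A) => (r 1, 1) ∈ K), Finset.filter_filter,
    Finset.filter_filter, ← sum_isPartialGraph_true hodd hA]
  congr 1
  · refine Finset.sum_congr (Finset.filter_congr fun K _ => ?_) fun _ _ => rfl
    simp [IsPartialGraph]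
  have h : Finset.univ.filter (fun K : Subgroup (DihedralGroup p × A) =>
      IsPartialGraph false K ∧ (r 1, 1) ∉ K) =
      insert ⊥ (Finset.univ.image fun q : ZMod p × A => Subgroup.zpowers (sr q.1, q.2)) := by
    ext K
    rw [Finset.mem_filter_univ, isPartialGraph_r_notMem_iff hodd hA]
    simp
  have hne : ∀ q : ZMod p × A, (sr q.1, q.2) ≠ (1 : DihedralGroup p × A) :=
    fun q h => sr_ne_one q.1 (congrArg Prod.fst h)
  have hinj : Function.Injective fun q : ZMod p × A => Subgroup.zpowers (sr q.1, q.2) := by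
    intro q q' hab
    have h1 : (sr q.1, q.2) ∈ Subgroup.zpowers (sr q.1, q.2) := Subgroup.mem_zpowers _
    simp only at hab
    rw [hab, mem_zpowers_of_mul_self (sr_mul_self_prod hA _ _)] at h1
    have := h1.resolve_left (hne q)
    simp only [Prod.mk.injEq, sr.injEq] at this
    exact Prod.ext this.1 this.2
  rw [h, Finset.sum_insert, Finset.sum_image fun a _ b _ h => hinj h, index_bot_dihedral]
  · simp only [index_zpowers_sr hA, Finset.sum_const, Finset.card_univ, nsmul_eq_mul,
      Nat.card_eq_fintype_card, Fintype.card_prod, ZMod.card]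
    push_cast
    ring
  · simp only [Finset.mem_image, Finset.mem_univ, true_and, not_exists]
    intro q h
    rw [Subgroup.zpowers_eq_bot] at h
    exact hne q h

/-- The number of actions of `D_p × A` on `n * |A|` points such that `A` acts freely (and the
rotations act trivially, if `b` holds), divided by `(n * |A|)!`. -/
noncomputable def normalizedCount (p : ℕ) (A : Type*) [Group A] (b : Bool) (n : ℕ) : ℚ :=
  (numActions (IsPartialGraph (p := p) (A := A) b) (n * Nat.card A) : ℚ) / (n * Nat.card A)!

theorem normalizedCount_recurrence [Fact p.Prime] [Finite A] (hodd : Odd p)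
    (hA : ∀ a : A, a * a = 1) (b : Bool) (n : ℕ) :
    (n : ℚ) * normalizedCount p A b n =
      shift (normalizedCount p A b) 1 n +
      shift (normalizedCount p A b) 2 n / Nat.card A +
      (if b then 0 else 1) * (p * shift (normalizedCount p A b) p n +
        shift (normalizedCount p A b) (2 * p) n / Nat.card A) := by
  have hτ : 0 < Nat.card A := Nat.card_pos
  have hτ' : (Nat.card A : ℚ) ≠ 0 := by positivity
  have := Fintype.ofFinite (Subgroup (DihedralGroup p × A))
  have h := numActions_div_factorial_recurrence (isPartialGraph_conj (p := p) hA b)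
    (n * Nat.card A)
  -- Every index is a multiple `d * |A|`, so removing an orbit lowers `n` by `d`.
  have hψ : ∀ d : ℕ, (if d * Nat.card A ≤ n * Nat.card A then
      (numActions (IsPartialGraph (p := p) (A := A) b) (n * Nat.card A - d * Nat.card A) : ℚ) /
        (n * Nat.card A - d * Nat.card A)! else 0) = shift (normalizedCount p A b) d n := by
    intro d
    simp only [mul_le_mul_iff_left₀ hτ, ← Nat.sub_mul]
    rfl
  have h1 := hψ 1
  rw [one_mul] at h1
  apply mul_left_cancel₀ hτ'
  have hl : (Nat.card A : ℚ) * (n * normalizedCount p A b n) =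
      ((n * Nat.card A : ℕ) : ℚ) * ((numActions (IsPartialGraph (p := p) (A := A) b)
        (n * Nat.card A) : ℚ) / (n * Nat.card A)!) := by
    rw [normalizedCount]; push_cast; ring
  rw [hl, h]
  cases b
  · rw [sum_isPartialGraph_false hodd hA (fun d => if d ≤ n * Nat.card A then
      (numActions (IsPartialGraph (p := p) (A := A) false) (n * Nat.card A - d) : ℚ) /
        (n * Nat.card A - d)! else 0)]
    simp only [hψ, h1, Bool.false_eq_true, if_false]
    field_simp
  · rw [sum_isPartialGraph_true hodd hA (fun d => if d ≤ n * Nat.card A then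
      (numActions (IsPartialGraph (p := p) (A := A) true) (n * Nat.card A - d) : ℚ) /
        (n * Nat.card A - d)! else 0)]
    simp only [hψ, h1, if_true]
    field_simp
    ring

theorem normalizedCount_zero (b : Bool) : normalizedCount p A b 0 = 1 := by
  have : Nat.card (ActionWith (IsPartialGraph (p := p) (A := A) b) (Fin 0)) = 1 := by
    rw [Nat.card_eq_one_iff_unique]
    exact ⟨⟨fun f g => Subtype.ext (by ext g x; exact x.elim0)⟩, ⟨⟨1, fun x => x.elim0⟩⟩⟩
  simp [normalizedCount, numActions, this]

end DihedralSubgroups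

/-! ### Power series coefficients with the same recurrence. -/

section ClosedForm

/-- The coefficients of the product of `∑ A n xⁿ` with `∑ w k x^(q k)`. -/
def sparseConv (q : ℕ) (w A : ℕ → ℚ) (n : ℕ) : ℚ :=
  ∑ k ∈ Finset.range (n + 1), w k * shift A (k * q) n

theorem sparseConv_eq_sum_range {q : ℕ} (hq : 0 < q) (w A : ℕ → ℚ) {n M : ℕ} (hM : n < M) :
    sparseConv q w A n = ∑ k ∈ Finset.range M, w k * shift A (k * q) n := by
  refine Finset.sum_subset (Finset.range_mono hM) fun k _ hk => ?_
  rw [Finset.mem_range, not_lt] at hk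
  rw [shift, if_neg (by nlinarith), mul_zero]

theorem sparseConv_eq_sum_Icc {q : ℕ} (hq : 0 < q) (w A : ℕ → ℚ) (n : ℕ) :
    sparseConv q w A n = ∑ k ∈ Finset.Icc 0 (n / q), w k * A (n - k * q) := by
  symm
  have hle : ∀ k ∈ Finset.Icc 0 (n / q), k * q ≤ n := fun k hk =>
    (Nat.le_div_iff_mul_le hq).1 (Finset.mem_Icc.1 hk).2
  rw [Finset.sum_congr rfl fun k hk =>
    show w k * A (n - k * q) = w k * shift A (k * q) n by rw [shift, if_pos (hle k hk)]]
  refine Finset.sum_subset (fun k hk => ?_) fun k _ hk => ?_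
  · have := hle k hk
    rw [Finset.mem_range]
    nlinarith
  · rw [Finset.mem_Icc, not_and, Nat.le_div_iff_mul_le hq] at hk
    rw [shift, if_neg (hk (Nat.zero_le _)), mul_zero]

theorem shift_shift (A : ℕ → ℚ) (c d n : ℕ) : shift (shift A c) d n = shift A (c + d) n := by
  unfold shift
  split_ifs <;> first | rfl | omega | (congr 1; omega)

theorem shift_sparseConv {q : ℕ} (hq : 0 < q) (w A : ℕ → ℚ) (d n M : ℕ) (hM : n < M) :
    shift (sparseConv q w A) d n = ∑ k ∈ Finset.range M, w k * shift A (k * q + d) n := by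
  by_cases hd : d ≤ n
  · rw [shift, if_pos hd, sparseConv_eq_sum_range hq w A (M := M) (by omega)]
    refine Finset.sum_congr rfl fun k _ => ?_
    rw [← shift_shift, shift.eq_1 (shift A _), if_pos hd]
  · rw [shift, if_neg hd]
    refine (Finset.sum_eq_zero fun k _ => ?_).symm
    rw [shift, if_neg (by omega), mul_zero]

theorem sum_shift_mul (w g : ℕ → ℚ) (d M : ℕ) :
    ∑ k ∈ Finset.range (M + d), shift w d k * g k = ∑ k ∈ Finset.range M, w k * g (k + d) := by
  rw [add_comm, Finset.sum_range_add, Finset.sum_eq_zero, zero_add]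
  · refine Finset.sum_congr rfl fun k _ => ?_
    rw [shift, if_pos (by omega), Nat.add_sub_cancel_left, add_comm]
  · intro k hk
    rw [shift, if_neg (by simpa using hk), zero_mul]

/-- A recurrence of this shape says `x F' = (a₁ x + a₂ x²) F` for the generating series. Logarithmic
derivatives add under products, and substituting `x^q` into the series of `w` multiplies its
coefficients `w₁`, `w₂` by `q`. -/
theorem sparseConv_recurrence {q : ℕ} (hq : 0 < q) {w A : ℕ → ℚ} {a₁ a₂ w₁ w₂ : ℚ}
    (hA : ∀ n : ℕ, n * A n = a₁ * shift A 1 n + a₂ * shift A 2 n)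
    (hw : ∀ k : ℕ, k * w k = w₁ * shift w 1 k + w₂ * shift w 2 k) (n : ℕ) :
    n * sparseConv q w A n = a₁ * shift (sparseConv q w A) 1 n +
      a₂ * shift (sparseConv q w A) 2 n + q * w₁ * shift (sparseConv q w A) q n +
      q * w₂ * shift (sparseConv q w A) (2 * q) n := by
  have hS : ∀ d M, n < M → shift (sparseConv q w A) d n =
      ∑ k ∈ Finset.range M, w k * shift A (k * q + d) n :=
    fun d M hM => shift_sparseConv hq w A d n M hM
  -- The ranges `n + 2` here and `n + 1` below both become `n + 3` after reindexing, so all sums can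
  -- be compared termwise.
  have h1 : shift (sparseConv q w A) q n =
      ∑ k ∈ Finset.range (n + 3), shift w 1 k * shift A (k * q) n := by
    rw [hS q (n + 2) (by omega), sum_shift_mul w (fun k => shift A (k * q) n) 1]
    simp only [add_mul, one_mul]
  have h2 : shift (sparseConv q w A) (2 * q) n =
      ∑ k ∈ Finset.range (n + 3), shift w 2 k * shift A (k * q) n := by
    rw [hS (2 * q) (n + 1) (by omega), sum_shift_mul w (fun k => shift A (k * q) n) 2]
    simp only [add_mul]
  rw [h1, h2, hS 1 (n + 3) (by omega), hS 2 (n + 3) (by omega),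
    sparseConv_eq_sum_range hq w A (M := n + 3) (by omega)]
  simp only [Finset.mul_sum, ← Finset.sum_add_distrib]
  refine Finset.sum_congr rfl fun k _ => ?_
  have hk : (n : ℚ) * shift A (k * q) n = k * q * shift A (k * q) n +
      (a₁ * shift A (k * q + 1) n + a₂ * shift A (k * q + 2) n) := by
    by_cases h : k * q ≤ n
    · have e := hA (n - k * q)
      rw [Nat.cast_sub h] at e
      have e1 : shift A (k * q + 1) n = shift A 1 (n - k * q) := by
        rw [add_comm, ← shift_shift, shift, if_pos h]
      have e2 : shift A (k * q + 2) n = shift A 2 (n - k * q) := by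
        rw [add_comm, ← shift_shift, shift, if_pos h]
      rw [e1, e2, ← e, shift, if_pos h]
      push_cast
      ring
    · simp only [shift, if_neg h, if_neg (show ¬ k * q + 1 ≤ n by omega),
        if_neg (show ¬ k * q + 2 ≤ n by omega)]
      ring
  linear_combination (w k) * hk + (q * shift A (k * q) n) * hw k

/-- The coefficients of `exp (x + x² / c)`. -/
def involutionCoeff (c : ℚ) : ℕ → ℚ :=
  sparseConv 2 (fun m => 1 / (m ! * c ^ m)) (fun n => 1 / n !)

theorem inv_factorial_recurrence (c : ℚ) (m : ℕ) :
    m * (1 / (m ! * c ^ m)) = 1 / c * shift (fun m : ℕ => 1 / (m ! * c ^ m)) 1 m +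
      0 * shift (fun m : ℕ => 1 / (m ! * c ^ m)) 2 m := by
  rcases m with _ | m
  · simp [shift]
  · simp only [shift, le_add_iff_nonneg_left, zero_le, if_true, Nat.factorial_succ,
      Nat.add_sub_cancel]
    push_cast
    have : ((m : ℚ) + 1) ≠ 0 := by positivity
    have : (m ! : ℚ) ≠ 0 := by positivity
    -- For `c = 0` both sides vanish, division by zero being zero.
    rcases eq_or_ne c 0 with rfl | hc
    · simp
    field_simp
    simp [pow_succ']

theorem involutionCoeff_recurrence (c : ℚ) (n : ℕ) :
    n * involutionCoeff c n =
      1 * shift (involutionCoeff c) 1 n + 2 / c * shift (involutionCoeff c) 2 n := by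
  have h := sparseConv_recurrence (q := 2) (w := fun m => 1 / (m ! * c ^ m))
    (A := fun n => 1 / n !) two_pos (a₁ := 1) (a₂ := 0)
    (by simpa using inv_factorial_recurrence 1) (inv_factorial_recurrence c) n
  rw [involutionCoeff, h]
  push_cast
  ring

/-- The coefficients of `exp (x + x² / (2t) + y xᵖ + y² x²ᵖ / (2tp))`. -/
def dihedralCoeff (p : ℕ) (t y : ℚ) : ℕ → ℚ :=
  sparseConv p (fun k => y ^ k * involutionCoeff (2 * t * p) k) (involutionCoeff (2 * t))

theorem dihedralCoeff_recurrence {p : ℕ} (hp : 0 < p) {t : ℚ} (ht : t ≠ 0) (y : ℚ) (n : ℕ) :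
    n * dihedralCoeff p t y n = shift (dihedralCoeff p t y) 1 n +
      shift (dihedralCoeff p t y) 2 n / t +
      y * (p * shift (dihedralCoeff p t y) p n + y * shift (dihedralCoeff p t y) (2 * p) n / t) := by
  have hp' : (p : ℚ) ≠ 0 := by positivity
  have h := sparseConv_recurrence (q := p) (w := fun k => y ^ k * involutionCoeff (2 * t * p) k)
    (A := involutionCoeff (2 * t)) hp (involutionCoeff_recurrence (2 * t))
    -- The factor `y ^ k` rescales the variable: the coefficients `1` and `2 / (2tp)` acquire the
    -- factors `y` and `y ^ 2`.
    (w₁ := y) (w₂ := y ^ 2 / (t * p)) (fun k => by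
      have := involutionCoeff_recurrence (2 * t * p) k
      have e : (k : ℚ) * (y ^ k * involutionCoeff (2 * t * p) k) =
        y ^ k * (k * involutionCoeff (2 * t * p) k) := by ring
      rw [e, this]
      unfold shift
      rcases k with _ | _ | k
      · simp
      · simp
      · simp only [if_true, Nat.add_sub_cancel, pow_succ,
          show 1 ≤ k + 1 + 1 by omega, show k + 1 + 1 - 2 = k by omega,
          show 2 ≤ k + 1 + 1 by omega]
        field_simp) n
  rw [dihedralCoeff, h]
  field_simp
  ring

theorem eq_of_recurrence {p : ℕ} (hp : 0 < p) {t y : ℚ} {u v : ℕ → ℚ} (h0 : u 0 = v 0)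
    (hu : ∀ n : ℕ, n * u n = shift u 1 n + shift u 2 n / t +
      y * (p * shift u p n + y * shift u (2 * p) n / t))
    (hv : ∀ n : ℕ, n * v n = shift v 1 n + shift v 2 n / t +
      y * (p * shift v p n + y * shift v (2 * p) n / t)) (n : ℕ) : u n = v n := by
  induction n using Nat.strong_induction_on with
  | _ n ih =>
    rcases Nat.eq_zero_or_pos n with rfl | hn
    · exact h0
    · have hs : ∀ d, 0 < d → shift u d n = shift v d n := by
        intro d hd
        unfold shift
        split_ifs with h
        · exact ih _ (by omega)
        · rfl
      have hn' : (n : ℚ) ≠ 0 := by positivity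
      apply mul_left_cancel₀ hn'
      rw [hu, hv, hs 1 one_pos, hs 2 two_pos, hs p hp, hs (2 * p) (by omega)]

theorem involutionCoeff_eq_sum (c : ℚ) (n : ℕ) :
    involutionCoeff c n = ∑ m ∈ Finset.Icc 0 (n / 2), 1 / ((n - 2 * m)! * m ! * c ^ m) := by
  rw [involutionCoeff, sparseConv_eq_sum_Icc two_pos]
  refine Finset.sum_congr rfl fun m _ => ?_
  rw [mul_comm m 2, ← one_div_mul_one_div, ← one_div_mul_one_div, ← one_div_mul_one_div]
  ring

/-- The condition `hτ`, valid for `τ = 1` and `τ = 2`, turns the powers of `2τ` from the exponential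
into the powers of `2 ^ τ` in `denom`. -/
theorem dihedralCoeff_eq_sum {p : ℕ} (hp : 0 < p) {τ : ℕ} (hτ : 2 * τ = 2 ^ τ) (y : ℚ) (n : ℕ) :
    dihedralCoeff p τ y n = ∑ k ∈ Finset.Icc 0 (n / p), y ^ k * ∑ l ∈ Finset.Icc 0 (k / 2),
      ∑ m ∈ Finset.Icc 0 ((n - k * p) / 2), 1 / denom p n τ k l m := by
  have hτ' : (2 : ℚ) * τ = 2 ^ τ := by exact_mod_cast hτ
  rw [dihedralCoeff, sparseConv_eq_sum_Icc hp]
  refine Finset.sum_congr rfl fun k _ => ?_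
  rw [involutionCoeff_eq_sum, involutionCoeff_eq_sum, mul_assoc, Finset.sum_mul_sum]
  congr 1
  refine Finset.sum_congr rfl fun l _ => Finset.sum_congr rfl fun m _ => ?_
  rw [one_div_mul_one_div, hτ', denom]
  push_cast
  congr 1
  rw [pow_mul, pow_add, mul_pow]
  ring

theorem dihedralCoeff_zero {p : ℕ} (t y : ℚ) : dihedralCoeff p t y 0 = 1 := by
  simp [dihedralCoeff, involutionCoeff, sparseConv, shift]

theorem normalizedCount_eq_dihedralCoeff {p : ℕ} [Fact p.Prime] {A : Type*} [Group A] [Finite A]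
    (hodd : Odd p) (hA : ∀ a : A, a * a = 1) (b : Bool) (n : ℕ) :
    normalizedCount p A b n = dihedralCoeff p (Nat.card A) (if b then 0 else 1) n := by
  have hp : 0 < p := (Fact.out : p.Prime).pos
  have ht : (Nat.card A : ℚ) ≠ 0 := by exact_mod_cast Nat.card_pos.ne'
  refine eq_of_recurrence hp (by rw [normalizedCount_zero, dihedralCoeff_zero]) (fun n => ?_)
    (dihedralCoeff_recurrence hp ht _) n
  rw [normalizedCount_recurrence hodd hA]
  cases b <;> simp

end ClosedForm

universe u v

/-! ### From homomorphisms into a centralizer to actions of `D_p × A`. -/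

section FreeActions

open DihedralGroup

variable {A : Type u} {X : Type v} [Group A]

/-- An action in which only the identity has fixed points. -/
def IsFreeAction (ρ : A →* Equiv.Perm X) : Prop := ∀ a x, ρ a x = x → a = 1

/-- Choosing a representative in each orbit identifies the orbit with `A`; `Ω` is the set of orbits.
-/
theorem IsFreeAction.exists_equiv_prod {ρ : A →* Equiv.Perm X} (hρ : IsFreeAction ρ) :
    ∃ (Ω : Type v) (e : Ω × A ≃ X), ∀ ω a b, e (ω, a * b) = ρ a (e (ω, b)) := by
  let s : Setoid X :=
    { r := fun x y => ∃ a, ρ a x = y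
      iseqv := ⟨fun x => ⟨1, by simp⟩, by
        rintro x y ⟨a, rfl⟩
        exact ⟨a⁻¹, by simp⟩, by
        rintro x y z ⟨a, rfl⟩ ⟨b, rfl⟩
        exact ⟨b * a, by simp⟩⟩ }
  refine ⟨Quotient s, Equiv.ofBijective (fun q : Quotient s × A => ρ q.2 q.1.out) ⟨?_, ?_⟩, ?_⟩
  · rintro ⟨ω, a⟩ ⟨ω', a'⟩ h
    simp only at h
    have h1 : ρ (a'⁻¹ * a) ω.out = ω'.out := by
      rw [map_mul, Equiv.Perm.mul_apply, h, ← Equiv.Perm.mul_apply, ← map_mul,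
        inv_mul_cancel, map_one, Equiv.Perm.one_apply]
    have h2 : ω = ω' := by
      rw [← Quotient.out_eq ω, ← Quotient.out_eq ω']
      exact Quotient.sound ⟨_, h1⟩
    subst h2
    rw [inv_mul_eq_one.1 (hρ _ _ h1)]
  · intro x
    obtain ⟨a, ha⟩ := Quotient.exact (s := s) (Quotient.out_eq (Quotient.mk s x))
    exact ⟨(Quotient.mk s x, a), ha⟩
  · intro ω a b
    change ρ (a * b) _ = ρ a (ρ b _)
    rw [map_mul, Equiv.Perm.mul_apply]

/-- Both actions have `|X| / |A|` orbits, each a copy of `A`; any matching of the orbits conjugates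
one action into the other. -/
theorem IsFreeAction.exists_conj [Finite A] [Finite X] {ρ ρ' : A →* Equiv.Perm X}
    (hρ : IsFreeAction ρ) (hρ' : IsFreeAction ρ') :
    ∃ σ : Equiv.Perm X, ∀ a, ρ' a = σ * ρ a * σ⁻¹ := by
  obtain ⟨Ω, e, he⟩ := hρ.exists_equiv_prod
  obtain ⟨Ω', e', he'⟩ := hρ'.exists_equiv_prod
  have hfin : Finite Ω := Finite.of_injective (fun ω => e (ω, 1)) fun ω ω' h => by
    simpa using e.injective h
  have hfin' : Finite Ω' := Finite.of_injective (fun ω => e' (ω, 1)) fun ω ω' h => by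
    simpa using e'.injective h
  have hcard : Nat.card Ω = Nat.card Ω' := by
    have h1 := Nat.card_congr e
    rw [← Nat.card_congr e', Nat.card_prod, Nat.card_prod] at h1
    exact Nat.eq_of_mul_eq_mul_right Nat.card_pos h1
  let i : Ω ≃ Ω' := (Finite.equivFinOfCardEq hcard).trans (Finite.equivFin Ω').symm
  refine ⟨e.symm.trans ((Equiv.prodCongr i (Equiv.refl A)).trans e'), fun a => ?_⟩
  rw [eq_mul_inv_iff_mul_eq]
  ext x
  obtain ⟨⟨ω, b⟩, rfl⟩ := e.surjective x
  simp [← he, ← he']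

variable {p : ℕ}

theorem actionWith_isPartialGraph_iff {b : Bool}
    {f : DihedralGroup p × A →* Equiv.Perm X} :
    (∀ x, IsPartialGraph b (pointStabilizer f x)) ↔
      IsFreeAction (f.comp (MonoidHom.inr _ A)) ∧ (b = true → f (r 1, 1) = 1) := by
  constructor
  · intro h
    exact ⟨fun a x hx => (h x).1 a hx, fun hb => Equiv.ext fun x => (h x).2 hb⟩
  · rintro ⟨h1, h2⟩ x
    refine ⟨fun a ha => h1 a x ha, fun hb => ?_⟩
    rw [mem_pointStabilizer, h2 hb]
    rfl

/-- Homomorphisms from the dihedral group which, if `b` holds, kill the rotations. -/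
def DihedralHom (p : ℕ) (b : Bool) (G : Type*) [Group G] : Type _ :=
  {f : DihedralGroup p →* G // b = true → f (r 1) = 1}

/-- After conjugating back by `σ`, an extension of `ρ` to `D_p × A` is a homomorphism from `D_p`
whose values commute with `ρ`. -/
theorem card_extensions {b : Bool} {ρ : A →* Equiv.Perm X} (hρ : IsFreeAction ρ)
    (σ : Equiv.Perm X) :
    Nat.card {f : ActionWith (IsPartialGraph (p := p) (A := A) b) X //
      ∀ a, f.1 (1, a) = σ * ρ a * σ⁻¹} =
    Nat.card (DihedralHom p b (Subgroup.centralizer (Set.range ρ))) := by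
  symm
  have hcomm : ∀ (w : Subgroup.centralizer (Set.range ρ)) a, Commute (w : Equiv.Perm X) (ρ a) :=
    fun w a => (Subgroup.mem_centralizer_iff.1 w.2 _ ⟨a, rfl⟩).symm
  let ext (χ : DihedralGroup p →* Subgroup.centralizer (Set.range ρ)) :
      DihedralGroup p × A →* Equiv.Perm X :=
    (MulAut.conj σ).toMonoidHom.comp
      (((Subgroup.subtype _).comp χ).noncommCoprod ρ fun g a => hcomm (χ g) a)
  have hext : ∀ χ g a, ext χ (g, a) = σ * ((χ g : Equiv.Perm X) * ρ a) * σ⁻¹ := fun χ g a => rfl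
  let F : DihedralHom p b (Subgroup.centralizer (Set.range ρ)) →
      {f : ActionWith (IsPartialGraph (p := p) (A := A) b) X //
        ∀ a, f.1 (1, a) = σ * ρ a * σ⁻¹} := fun χ =>
    ⟨⟨ext χ.1, actionWith_isPartialGraph_iff.2 ⟨fun a x hx => by
        rw [MonoidHom.comp_apply, MonoidHom.inr_apply, hext, map_one, OneMemClass.coe_one,
          one_mul, Equiv.Perm.mul_apply, Equiv.Perm.mul_apply, ← Equiv.Perm.eq_inv_iff_eq] at hx
        exact hρ a _ hx, fun hb => by
        rw [hext, χ.2 hb]; simp⟩⟩, fun a => by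
      change ext χ.1 (1, a) = _
      rw [hext]; simp⟩
  refine Nat.card_congr (Equiv.ofBijective F ⟨?_, ?_⟩)
  · intro χ χ' h
    apply Subtype.ext
    ext1 g
    have h1 : ext χ.1 (g, 1) = ext χ'.1 (g, 1) := by
      have h2 := congrArg (fun f => f.1.1 (g, 1)) h
      exact h2
    rw [hext, hext] at h1
    simpa using h1
  · rintro ⟨f, hf⟩
    have hf' : ∀ a, ρ a = σ⁻¹ * f.1 (1, a) * σ := fun a => by rw [hf]; group
    have hmem : ∀ g, σ⁻¹ * f.1 (g, 1) * σ ∈ Subgroup.centralizer (Set.range ρ) := by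
      intro g
      rw [Subgroup.mem_centralizer_iff, Set.forall_mem_range]
      intro a
      have h1 : f.1 (1, a) * f.1 (g, 1) = f.1 (g, 1) * f.1 (1, a) := by
        rw [← map_mul, ← map_mul]; simp
      calc ρ a * (σ⁻¹ * f.1 (g, 1) * σ) = σ⁻¹ * (f.1 (1, a) * f.1 (g, 1)) * σ := by
            rw [hf']; group
        _ = _ := by rw [h1, hf']; group
    let χ : DihedralGroup p →* Subgroup.centralizer (Set.range ρ) :=
      { toFun := fun g => ⟨σ⁻¹ * f.1 (g, 1) * σ, hmem g⟩
        map_one' := by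
          apply Subtype.ext
          change σ⁻¹ * f.1 1 * σ = 1
          rw [map_one]; group
        map_mul' := by
          intro g g'
          apply Subtype.ext
          change σ⁻¹ * f.1 (g * g', 1) * σ = (σ⁻¹ * f.1 (g, 1) * σ) * (σ⁻¹ * f.1 (g', 1) * σ)
          have : ((g * g', 1) : DihedralGroup p × A) = (g, 1) * (g', 1) := by simp
          rw [this, map_mul]; group }
    refine ⟨⟨χ, fun hb => ?_⟩, ?_⟩
    · apply Subtype.ext
      change σ⁻¹ * f.1 (r 1, 1) * σ = 1
      rw [(actionWith_isPartialGraph_iff.1 f.2).2 hb]; group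
    · apply Subtype.ext
      apply Subtype.ext
      apply MonoidHom.ext
      rintro ⟨g, a⟩
      change ext χ (g, a) = f.1 (g, a)
      rw [hext]
      change σ * (σ⁻¹ * f.1 (g, 1) * σ * ρ a) * σ⁻¹ = _
      have : ((g, a) : DihedralGroup p × A) = (g, 1) * (1, a) := by simp
      rw [this, map_mul, hf]; group

/-- The conjugators form a coset of the centralizer, nonempty because free actions are conjugate. -/
theorem card_conjugators [Finite A] [Finite X] {ρ ρ' : A →* Equiv.Perm X} (hρ : IsFreeAction ρ)
    (hρ' : IsFreeAction ρ') :
    Nat.card {σ : Equiv.Perm X // ∀ a, ρ' a = σ * ρ a * σ⁻¹} =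
      Nat.card (Subgroup.centralizer (Set.range ρ)) := by
  obtain ⟨σ₀, h₀⟩ := hρ.exists_conj hρ'
  refine Nat.card_congr ((Equiv.mulLeft σ₀⁻¹).subtypeEquiv fun σ => ?_)
  rw [Subgroup.mem_centralizer_iff, Set.forall_mem_range]
  refine forall_congr' fun a => ?_
  rw [h₀, Equiv.coe_mulLeft, eq_mul_inv_iff_mul_eq]
  constructor
  · intro h
    rw [mul_assoc, ← h]
    group
  · intro h
    have := congrArg (σ₀ * ·) h
    simp only [mul_assoc, mul_inv_cancel_left] at this ⊢
    exact this

/-- Double counting of the pairs `(σ, f)` for which `f` restricts on `A` to the conjugate of `ρ` by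
`σ`: over a fixed `σ` lie the extensions, over a fixed `f` the conjugators. -/
theorem card_dihedralHom_centralizer [NeZero p] [Finite A] [Finite X] (b : Bool)
    {ρ : A →* Equiv.Perm X} (hρ : IsFreeAction ρ) :
    (Nat.card X)! * Nat.card (DihedralHom p b (Subgroup.centralizer (Set.range ρ))) =
      numActions (IsPartialGraph (p := p) (A := A) b) (Nat.card X) *
        Nat.card (Subgroup.centralizer (Set.range ρ)) := by
  classical
  have := Fintype.ofFinite X
  have := Fintype.ofFinite (ActionWith (IsPartialGraph (p := p) (A := A) b) X)
  let T := {q : Equiv.Perm X × ActionWith (IsPartialGraph (p := p) (A := A) b) X //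
    ∀ a, q.2.1 (1, a) = q.1 * ρ a * q.1⁻¹}
  have h1 : Nat.card T = (Nat.card X)! *
      Nat.card (DihedralHom p b (Subgroup.centralizer (Set.range ρ))) := by
    rw [Nat.card_congr (Equiv.subtypeProdEquivSigmaSubtype (fun (σ : Equiv.Perm X)
      (f : ActionWith (IsPartialGraph (p := p) (A := A) b) X) =>
        ∀ a, f.1 (1, a) = σ * ρ a * σ⁻¹)), Nat.card_sigma,
      Finset.sum_congr rfl fun σ _ => card_extensions hρ σ, Finset.sum_const, Finset.card_univ,
      Fintype.card_perm, Nat.card_eq_fintype_card (α := X), smul_eq_mul]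
  let e : T ≃ {q : ActionWith (IsPartialGraph (p := p) (A := A) b) X × Equiv.Perm X //
      ∀ a, q.1.1 (1, a) = q.2 * ρ a * q.2⁻¹} :=
    (Equiv.prodComm _ _).subtypeEquiv fun _ => Iff.rfl
  rw [← h1, Nat.card_congr (e.trans (Equiv.subtypeProdEquivSigmaSubtype
    (fun (f : ActionWith (IsPartialGraph (p := p) (A := A) b) X) (σ : Equiv.Perm X) =>
        ∀ a, f.1 (1, a) = σ * ρ a * σ⁻¹))), Nat.card_sigma,
    Finset.sum_congr rfl fun f _ => card_conjugators hρ
      (ρ' := f.1.comp (MonoidHom.inr _ A)) (actionWith_isPartialGraph_iff.1 f.2).1,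
    Finset.sum_const, Finset.card_univ, smul_eq_mul, ← Nat.card_eq_fintype_card,
    card_actionWith]

theorem card_dihedralHom_eq_sum [Fact p.Prime] (hodd : Odd p) [Finite A]
    (hA : ∀ a : A, a * a = 1) (hτ : 2 * Nat.card A = 2 ^ Nat.card A) [Finite X]
    {ρ : A →* Equiv.Perm X} (hρ : IsFreeAction ρ) {n : ℕ} (hn : Nat.card X = n * Nat.card A)
    {W : Type*} [Group W] (e : W ≃* Subgroup.centralizer (Set.range ρ)) (b : Bool) :
    (Nat.card (DihedralHom p b W) : ℚ) = Nat.card W *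
      ∑ k ∈ Finset.Icc 0 (n / p), (if b then 0 else 1) ^ k * ∑ l ∈ Finset.Icc 0 (k / 2),
        ∑ m ∈ Finset.Icc 0 ((n - k * p) / 2), 1 / denom p n (Nat.card A) k l m := by
  have hp : 0 < p := (Fact.out : p.Prime).pos
  rw [← dihedralCoeff_eq_sum hp hτ, ← normalizedCount_eq_dihedralCoeff hodd hA, normalizedCount,
    ← hn, ← mul_div_assoc, eq_div_iff (by positivity), Nat.card_congr e.toEquiv]
  have h1 : Nat.card (DihedralHom p b W) =
      Nat.card (DihedralHom p b (Subgroup.centralizer (Set.range ρ))) :=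
    Nat.card_congr ((e.monoidHomCongrRightEquiv (M := DihedralGroup p)).subtypeEquiv fun f => by
      change _ ↔ (b = true → e (f (r 1)) = 1)
      rw [map_eq_one_iff e e.injective])
  have := card_dihedralHom_centralizer (p := p) b hρ
  rw [h1]
  norm_cast
  rw [mul_comm, this, mul_comm]

end FreeActions

/-! ### The symmetry group of the cube as a centralizer. -/

section Cube

variable {n : ℕ}

/-- The vectors `± e_i` of `ℝⁿ`. -/
noncomputable def signedBasis (q : Fin n × ℤˣ) : EuclideanSpace ℝ (Fin n) :=
  EuclideanSpace.single q.1 (((q.2 : ℤ) : ℝ))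

theorem inner_signedBasis (x : EuclideanSpace ℝ (Fin n)) (q : Fin n × ℤˣ) :
    inner ℝ x (signedBasis q) = ((q.2 : ℤ) : ℝ) * x q.1 := by
  simp [signedBasis, EuclideanSpace.inner_single_right]

theorem signedBasis_apply_self (q : Fin n × ℤˣ) : signedBasis q q.1 = ((q.2 : ℤ) : ℝ) := by
  simp [signedBasis]

theorem signedBasis_apply_of_ne (q : Fin n × ℤˣ) {j : Fin n} (h : j ≠ q.1) :
    signedBasis q j = 0 := by
  simp [signedBasis, h]

theorem unit_cast_mul_self (ε : ℤˣ) : ((ε : ℤ) : ℝ) * ((ε : ℤ) : ℝ) = 1 := by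
  rcases Int.units_eq_one_or ε with rfl | rfl <;> norm_num

theorem signedBasis_injective : Function.Injective (signedBasis (n := n)) := by
  rintro ⟨i, a⟩ ⟨j, b⟩ h
  have h1 := congrArg (fun v => v i) h
  simp only [signedBasis_apply_self (i, a)] at h1
  by_cases hij : i = j
  · subst hij
    rw [signedBasis_apply_self (i, b)] at h1
    have : (a : ℤ) = b := by exact_mod_cast h1
    rw [Units.ext this]
  · rw [signedBasis_apply_of_ne (j, b) hij] at h1
    have h2 := unit_cast_mul_self a
    rw [h1] at h2
    norm_num at h2

theorem signedBasis_mul (i : Fin n) (a b : ℤˣ) :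
    signedBasis (i, a * b) = ((a : ℤ) : ℝ) • signedBasis (i, b) := by
  ext j
  by_cases hij : j = i
  · subst hij
    simp [signedBasis]
  · simp [signedBasis, hij]

theorem norm_signedBasis (q : Fin n × ℤˣ) : ‖signedBasis q‖ = 1 := by
  rcases Int.units_eq_one_or q.2 with h | h <;> simp [signedBasis, h]

theorem mem_cube_iff_inner (x : EuclideanSpace ℝ (Fin n)) :
    x ∈ cube n ↔ ∀ q, inner ℝ x (signedBasis q) ≤ 1 := by
  simp only [inner_signedBasis]
  constructor
  · rintro h ⟨i, a⟩
    have := abs_le.1 (h i)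
    rcases Int.units_eq_one_or a with rfl | rfl <;> simp <;> linarith
  · intro h i
    have h1 := h (i, 1)
    have h2 := h (i, -1)
    simp at h1 h2
    exact abs_le.2 ⟨by linarith, by linarith⟩

/-- All `|v j| ≤ 1`, so `v j ^ 2 ≤ |v j|`; the two norm conditions force equality throughout, so
each `|v j|` is 0 or 1, and exactly one is 1. -/
theorem exists_eq_signedBasis {v : EuclideanSpace ℝ (Fin n)} (hnorm : ‖v‖ = 1)
    (hsum : ∑ j, |v j| ≤ 1) : ∃ q, v = signedBasis q := by
  have hsq : ∑ j, v j ^ 2 = 1 := by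
    rw [← EuclideanSpace.real_norm_sq_eq, hnorm, one_pow]
  have hle : ∀ j, |v j| ≤ 1 := fun j =>
    (Finset.single_le_sum (f := fun j => |v j|) (fun _ _ => abs_nonneg _)
      (Finset.mem_univ j)).trans hsum
  have hnn : ∀ j ∈ Finset.univ, 0 ≤ |v j| - v j ^ 2 := fun j _ => by
    have := hle j
    rw [← sq_abs]
    nlinarith [abs_nonneg (v j)]
  have hz : ∑ j, (|v j| - v j ^ 2) = 0 := by
    refine le_antisymm ?_ (Finset.sum_nonneg hnn)
    rw [Finset.sum_sub_distrib]
    linarith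
  have heq : ∀ j, |v j| = |v j| ^ 2 := fun j => by
    have := (Finset.sum_eq_zero_iff_of_nonneg hnn).1 hz j (Finset.mem_univ j)
    rw [sq_abs]
    linarith
  obtain ⟨i, hi⟩ : ∃ i, v i ≠ 0 := by
    by_contra! h
    simp [h] at hsq
  have hi1 : |v i| = 1 := by
    have h0 : |v i| ≠ 0 := abs_ne_zero.2 hi
    have := heq i
    rw [pow_two] at this
    exact (mul_left_cancel₀ h0 (by rw [mul_one]; exact this)).symm
  have hj : ∀ j, j ≠ i → v j = 0 := by
    intro j hji
    have h1 : |v i| + |v j| ≤ ∑ j, |v j| := by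
      rw [← Finset.sum_pair (f := fun j => |v j|) hji.symm]
      exact Finset.sum_le_sum_of_subset_of_nonneg (Finset.subset_univ _)
        fun _ _ _ => abs_nonneg _
    exact abs_nonpos_iff.1 (by linarith)
  obtain ⟨a, ha⟩ : ∃ a : ℤˣ, v i = ((a : ℤ) : ℝ) := by
    rcases eq_or_eq_neg_of_abs_eq hi1 with h | h
    · exact ⟨1, by simp [h]⟩
    · exact ⟨-1, by simp [h]⟩
  refine ⟨(i, a), ?_⟩
  ext j
  by_cases hij : j = i
  · subst hij
    rw [signedBasis_apply_self (j, a), ha]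
  · rw [signedBasis_apply_of_ne (i, a) hij, hj j hij]

theorem exists_map_signedBasis (w : symmetryGroupCube n) (q : Fin n × ℤˣ) :
    ∃ q', w.1 (signedBasis q) = signedBasis q' := by
  apply exists_eq_signedBasis
  · rw [LinearIsometryEquiv.norm_map, norm_signedBasis]
  · set v := w.1 (signedBasis q)
    -- The sign vector of `v` lies in the cube, and its inner product with `v` is `∑ |v j|`. Pulling
    -- it back by `w` bounds this sum by 1.
    let y : EuclideanSpace ℝ (Fin n) := WithLp.toLp 2 fun j => SignType.sign (v j)
    have hy : y ∈ cube n := by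
      intro j
      change |((SignType.sign (v j) : SignType) : ℝ)| ≤ 1
      rcases lt_trichotomy (v j) 0 with h | h | h <;> simp [h]
    have hw : w.1 '' cube n = cube n := w.2
    rw [← hw] at hy
    obtain ⟨x, hx, hxy⟩ := hy
    have h1 := (mem_cube_iff_inner x).1 hx q
    rw [← w.1.inner_map_map, hxy, PiLp.inner_apply] at h1
    refine le_of_eq_of_le (Finset.sum_congr rfl fun j _ => ?_) h1
    change |v j| = inner ℝ (((SignType.sign (v j) : SignType) : ℝ)) (v j)
    rw [RCLike.inner_apply, conj_trivial, mul_comm, sign_mul_self]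

/-- The action of `±1` on the signed coordinate vectors. -/
def signAction (n : ℕ) : ℤˣ →* Equiv.Perm (Fin n × ℤˣ) where
  toFun a := Equiv.prodCongr (Equiv.refl _) (Equiv.mulLeft a)
  map_one' := by ext x <;> simp
  map_mul' a b := by ext x <;> simp [mul_assoc]

theorem signAction_apply (a : ℤˣ) (q : Fin n × ℤˣ) : signAction n a q = (q.1, a * q.2) := rfl

theorem isFreeAction_signAction (n : ℕ) : IsFreeAction (signAction n) := by
  intro a q h
  have := congrArg Prod.snd h
  rw [signAction_apply] at this
  simpa using this

theorem signedBasis_signAction (a : ℤˣ) (q : Fin n × ℤˣ) :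
    signedBasis (signAction n a q) = ((a : ℤ) : ℝ) • signedBasis q := by
  rw [signAction_apply, signedBasis_mul]

/-- The permutation action of the symmetries of the cube on the signed coordinate vectors. -/
noncomputable def cubePermHom (n : ℕ) : symmetryGroupCube n →* Equiv.Perm (Fin n × ℤˣ) :=
  MonoidHom.toHomPerm
    { toFun := fun w q => (exists_map_signedBasis w q).choose
      map_one' := by
        funext q
        apply signedBasis_injective
        exact (exists_map_signedBasis 1 q).choose_spec.symm
      map_mul' := by
        intro w w'
        funext q
        apply signedBasis_injective
        change _ = signedBasis (exists_map_signedBasis w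
          (exists_map_signedBasis w' q).choose).choose
        rw [← (exists_map_signedBasis (w * w') q).choose_spec,
          ← (exists_map_signedBasis w _).choose_spec,
          ← (exists_map_signedBasis w' q).choose_spec]
        rfl }

theorem signedBasis_cubePermHom (w : symmetryGroupCube n) (q : Fin n × ℤˣ) :
    signedBasis (cubePermHom n w q) = w.1 (signedBasis q) :=
  (exists_map_signedBasis w q).choose_spec.symm

theorem cubePermHom_mem (w : symmetryGroupCube n) :
    cubePermHom n w ∈ Subgroup.centralizer (Set.range (signAction n)) := by
  rw [Subgroup.mem_centralizer_iff, Set.forall_mem_range]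
  intro a
  ext1 q
  apply signedBasis_injective
  rw [Equiv.Perm.mul_apply, Equiv.Perm.mul_apply, signedBasis_signAction, signedBasis_cubePermHom,
    signedBasis_cubePermHom, signedBasis_signAction, map_smul]

theorem cubePermHom_injective : Function.Injective (cubePermHom n) := by
  intro w w' h
  apply Subtype.ext
  apply LinearIsometryEquiv.toLinearEquiv_injective
  apply LinearEquiv.toLinearMap_injective
  refine (EuclideanSpace.basisFun (Fin n) ℝ).toBasis.ext fun i => ?_
  have h1 := signedBasis_cubePermHom w (i, 1)
  rw [h, signedBasis_cubePermHom] at h1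
  simpa [signedBasis] using h1.symm

theorem exists_cubePermHom_eq {σ : Equiv.Perm (Fin n × ℤˣ)}
    (hσ : σ ∈ Subgroup.centralizer (Set.range (signAction n))) :
    ∃ w, cubePermHom n w = σ := by
  rw [Subgroup.mem_centralizer_iff, Set.forall_mem_range] at hσ
  have hσ' : ∀ i a b, σ (i, a * b) = signAction n a (σ (i, b)) := fun i a b => by
    rw [← Equiv.Perm.mul_apply, hσ]; rfl
  -- Equal first coordinates would make the two images differ by a sign, hence also their preimages,
  -- as `σ` commutes with signs.
  have hne : ∀ i j, i ≠ j → (σ (i, 1)).1 ≠ (σ (j, 1)).1 := by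
    intro i j hij h
    have h1 : σ (i, 1) = σ (j, (σ (i, 1)).2 * (σ (j, 1)).2⁻¹ * 1) := by
      rw [hσ', signAction_apply, ← h, inv_mul_cancel_right]
    exact hij (congrArg Prod.fst (σ.injective h1))
  have hon : Orthonormal ℝ fun i => signedBasis (σ (i, 1)) := by
    refine ⟨fun i => norm_signedBasis _, fun i j hij => ?_⟩
    simp only
    rw [inner_signedBasis, signedBasis_apply_of_ne _ (hne i j hij).symm, mul_zero]
  let ob : OrthonormalBasis (Fin n) ℝ (EuclideanSpace ℝ (Fin n)) :=
    OrthonormalBasis.mk hon (by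
      rw [hon.linearIndependent.span_eq_top_of_card_eq_finrank' (by simp)])
  let w : EuclideanSpace ℝ (Fin n) ≃ₗᵢ[ℝ] EuclideanSpace ℝ (Fin n) :=
    (EuclideanSpace.basisFun (Fin n) ℝ).equiv ob (Equiv.refl _)
  have hw : ∀ q, w (signedBasis q) = signedBasis (σ q) := by
    rintro ⟨i, a⟩
    have h1 : w (signedBasis (i, 1)) = signedBasis (σ (i, 1)) := by
      have := (EuclideanSpace.basisFun (Fin n) ℝ).equiv_apply_basis ob (Equiv.refl _) i
      simpa [ob, signedBasis, w] using this
    rw [← mul_one a, signedBasis_mul, map_smul, h1, hσ', signedBasis_signAction]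
  -- The cube is cut out by the inequalities `⟨x, ± e_i⟩ ≤ 1`, which `w` permutes.
  have hcube : ∀ x, w x ∈ cube n ↔ x ∈ cube n := by
    intro x
    rw [mem_cube_iff_inner, mem_cube_iff_inner, σ.surjective.forall]
    simp only [← hw, LinearIsometryEquiv.inner_map_map]
  have hmem : w '' cube n = cube n := by
    ext y
    obtain ⟨x, rfl⟩ := w.surjective y
    rw [w.injective.mem_set_image, hcube]
  refine ⟨⟨w, hmem⟩, ?_⟩
  ext1 q
  apply signedBasis_injective
  rw [signedBasis_cubePermHom]
  exact hw q

/-- The symmetry group of the cube is the group of signed permutations. -/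
noncomputable def symmetryGroupCubeEquiv (n : ℕ) :
    symmetryGroupCube n ≃* Subgroup.centralizer (Set.range (signAction n)) :=
  MulEquiv.ofBijective ((cubePermHom n).codRestrict _ cubePermHom_mem)
    ⟨fun _ _ h => cubePermHom_injective (congrArg Subtype.val h), fun σ => by
      obtain ⟨w, hw⟩ := exists_cubePermHom_eq σ.2
      exact ⟨w, Subtype.ext hw⟩⟩

instance finite_symmetryGroupCube (n : ℕ) : Finite (symmetryGroupCube n) :=
  Finite.of_equiv _ (symmetryGroupCubeEquiv n).symm.toEquiv

end Cube

/-- Every permutation commutes with the trivial action of the trivial group. -/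
def permEquivCentralizer (X : Type*) :
    Equiv.Perm X ≃* Subgroup.centralizer (Set.range (1 : Unit →* Equiv.Perm X)) :=
  Subgroup.topEquiv.symm.trans (MulEquiv.subgroupCongr (by
    symm
    rw [Subgroup.eq_top_iff']
    intro σ
    rw [Subgroup.mem_centralizer_iff, Set.forall_mem_range]
    intro a
    simp))

/-! ### From injective homomorphisms to subgroups. -/

section SubgroupCounting

open DihedralGroup

/-- Injective homomorphisms with a given image differ by a unique automorphism of `D`. -/
theorem card_subgroups_mul_card_aut {D G : Type*} [Group D] [Finite D] [Group G] [Finite G] :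
    Nat.card {H : Subgroup G // Nonempty (H ≃* D)} * Nat.card (D ≃* D) =
      Nat.card {f : D →* G // Function.Injective f} := by
  classical
  let e : {f : D →* G // Function.Injective f} ≃
      Σ H : {H : Subgroup G // Nonempty (H ≃* D)}, {f : D →* G // Function.Injective f ∧
        f.range = H.1} :=
    { toFun := fun f => ⟨⟨f.1.range, ⟨(MonoidHom.ofInjective f.2).symm⟩⟩, ⟨f.1, f.2, rfl⟩⟩
      invFun := fun q => ⟨q.2.1, q.2.2.1⟩
      left_inv := fun f => rfl
      right_inv := by
        rintro ⟨⟨H, hH⟩, ⟨f, hf, h⟩⟩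
        simp only at h
        subst h
        rfl }
  have hfib : ∀ H : {H : Subgroup G // Nonempty (H ≃* D)},
      Nat.card {f : D →* G // Function.Injective f ∧ f.range = H.1} = Nat.card (D ≃* D) := by
    rintro ⟨H, ⟨i⟩⟩
    symm
    let F : (D ≃* D) → {f : D →* G // Function.Injective f ∧ f.range = H} := fun a =>
      ⟨H.subtype.comp (a.trans i.symm).toMonoidHom,
        H.subtype_injective.comp (a.trans i.symm).injective, by
          rw [MonoidHom.range_comp, MonoidHom.range_eq_top.2 (a.trans i.symm).surjective,
            ← MonoidHom.range_eq_map, Subgroup.range_subtype]⟩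
    refine Nat.card_congr (Equiv.ofBijective F ⟨fun a a' h => ?_, ?_⟩)
    · ext x
      have h1 := congrArg (fun f => f.1 x) h
      exact i.symm.injective (Subtype.ext h1)
    · rintro ⟨f, hf, h⟩
      simp only at h
      subst h
      refine ⟨(MonoidHom.ofInjective hf).trans i, Subtype.ext (MonoidHom.ext fun x => ?_)⟩
      change ((i.symm (i (MonoidHom.ofInjective hf x)) : f.range) : G) = f x
      rw [MulEquiv.symm_apply_apply]
      rfl
  have := Fintype.ofFinite {H : Subgroup G // Nonempty (H ≃* D)}
  rw [Nat.card_congr e]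
  have : Finite (D ≃* D) := Finite.of_injective _ DFunLike.coe_injective
  have : ∀ H : {H : Subgroup G // Nonempty (H ≃* D)},
      Finite {f : D →* G // Function.Injective f ∧ f.range = H.1} := fun H =>
    Nat.finite_of_card_ne_zero (by rw [hfib]; exact Nat.card_pos.ne')
  rw [Nat.card_sigma, Finset.sum_congr rfl fun H _ => hfib H, Finset.sum_const,
    Finset.card_univ, smul_eq_mul, Nat.card_eq_fintype_card]

variable {p : ℕ}

/-- A nontrivial kernel contains a nontrivial rotation: if it contains `sr i`, it contains the
commutator `r 2`, nontrivial as `p` is odd. Any such rotation generates `r 1`. -/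
theorem dihedral_injective_iff [Fact p.Prime] (hodd : Odd p) {G : Type*} [Group G]
    (f : DihedralGroup p →* G) : Function.Injective f ↔ f (r 1) ≠ 1 := by
  have hr : ∀ i : ZMod p, i ≠ 0 → f (r i) = 1 → f (r 1) = 1 := by
    intro i hi h
    have : r (1 : ZMod p) = r i ^ (i⁻¹).val := by
      rw [r_pow, ZMod.natCast_val, ZMod.cast_id, mul_inv_cancel₀ hi]
    rw [this, map_pow, h, one_pow]
  have h2 : (2 : ZMod p) ≠ 0 := by
    intro h
    have h3 : p ∣ 2 := (ZMod.natCast_eq_zero_iff 2 p).1 (by exact_mod_cast h)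
    have h4 := (Fact.out : p.Prime).two_le
    have h5 := Nat.le_of_dvd two_pos h3
    have h6 : p = 2 := by omega
    rw [h6] at hodd
    exact absurd hodd (by decide)
  constructor
  · intro hf h
    exact r_one_ne_one (hf (h.trans (map_one f).symm))
  · intro h
    rw [injective_iff_map_eq_one]
    rintro (i | i) hi
    · rw [one_def]
      by_contra hne
      exact h (hr i (fun h0 => hne (by rw [h0])) hi)
    · exfalso
      apply h (hr 2 h2 _)
      have : r (2 : ZMod p) = r 1 * sr i * r (-1) * sr i := by
        rw [r_mul_sr, sr_mul_r, sr_mul_sr]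
        congr 1
        ring
      rw [this, map_mul, map_mul, map_mul, hi, mul_one, mul_one, ← map_mul, r_mul_r,
        add_neg_cancel, r_zero, map_one]

/-- The automorphism `r k ↦ r (i k)`, `sr k ↦ sr (j + i k)`, as an endomorphism. -/
def affineHom (i j : ZMod p) : DihedralGroup p →* DihedralGroup p where
  toFun
    | r k => r (i * k)
    | sr k => sr (j + i * k)
  map_one' := by
    change r (i * 0) = 1
    rw [mul_zero]; rfl
  map_mul' := by
    rintro (k | k) (l | l)
    · change r (i * (k + l)) = r (i * k) * r (i * l)
      rw [r_mul_r, mul_add]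
    · change sr (j + i * (l - k)) = r (i * k) * sr (j + i * l)
      rw [r_mul_sr]; congr 1; ring
    · change sr (j + i * (k + l)) = sr (j + i * k) * r (i * l)
      rw [sr_mul_r]; congr 1; ring
    · change r (i * (l - k)) = sr (j + i * k) * sr (j + i * l)
      rw [sr_mul_sr]; congr 1; ring

theorem affineHom_r (i j k : ZMod p) : affineHom i j (r k) = r (i * k) := rfl

theorem affineHom_sr (i j k : ZMod p) : affineHom i j (sr k) = sr (j + i * k) := rfl

/-- An involution cannot map to a rotation, whose order divides the odd number `p`. So reflections
go to reflections, and the images of `sr 0` and `sr 1` determine `f`. -/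
theorem exists_eq_affineHom [Fact p.Prime] (hodd : Odd p) {f : DihedralGroup p →* DihedralGroup p}
    (hf : Function.Injective f) : ∃ i j, f = affineHom i j := by
  have hsr : ∀ i : ZMod p, ∃ j, f (sr i) = sr j := by
    intro i
    rcases h : f (sr i) with k | k
    · exfalso
      have h1 : f (sr i) * f (sr i) = 1 := by rw [← map_mul, sr_mul_self, map_one]
      have h2 : (f (sr i)) ^ p = 1 := by
        rw [h, r_pow]; simp
      obtain ⟨m, hm⟩ := hodd
      have h3 : f (sr i) ^ p = f (sr i) := by
        conv_lhs => arg 2; rw [hm]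
        rw [pow_succ, pow_mul, pow_two, h1, one_pow, one_mul]
      exact sr_ne_one i (hf ((h3.symm.trans h2).trans (map_one f).symm))
    · exact ⟨k, rfl⟩
  obtain ⟨j, hj⟩ := hsr 0
  obtain ⟨j', hj'⟩ := hsr 1
  have hr1 : f (r 1) = r (j' - j) := by
    have : r (1 : ZMod p) = sr 0 * sr 1 := by rw [sr_mul_sr, sub_zero]
    rw [this, map_mul, hj, hj', sr_mul_sr]
  have hr : ∀ k, f (r k) = r ((j' - j) * k) := by
    intro k
    have : r k = r (1 : ZMod p) ^ k.val := by
      rw [r_pow, ZMod.natCast_val, ZMod.cast_id, one_mul]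
    rw [this, map_pow, hr1, r_pow, ZMod.natCast_val, ZMod.cast_id]
  refine ⟨j' - j, j, MonoidHom.ext ?_⟩
  rintro (k | k)
  · rw [hr, affineHom_r]
  · have : sr k = sr 0 * r k := by rw [sr_mul_r, zero_add]
    rw [affineHom_sr, this, map_mul, hj, hr, sr_mul_r]

theorem card_dihedral_aut [Fact p.Prime] (hodd : Odd p) :
    Nat.card (DihedralGroup p ≃* DihedralGroup p) = p * (p - 1) := by
  have hinj : ∀ (i : (ZMod p)ˣ) j, Function.Injective (affineHom (i : ZMod p) j) := by
    intro i j
    rw [dihedral_injective_iff hodd, affineHom_r, one_def, mul_one]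
    intro h
    injection h with h
    exact i.ne_zero h
  let F : ZMod p × (ZMod p)ˣ → (DihedralGroup p ≃* DihedralGroup p) := fun q =>
    MulEquiv.ofBijective (affineHom (q.2 : ZMod p) q.1)
      (Finite.injective_iff_bijective.1 (hinj q.2 q.1))
  have hF : Function.Bijective F := by
    constructor
    · rintro ⟨j, i⟩ ⟨j', i'⟩ h
      have h1 : affineHom (i : ZMod p) j (r 1) = affineHom (i' : ZMod p) j' (r 1) :=
        DFunLike.congr_fun h (r 1)
      have h2 : affineHom (i : ZMod p) j (sr 0) = affineHom (i' : ZMod p) j' (sr 0) :=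
        DFunLike.congr_fun h (sr 0)
      rw [affineHom_r, affineHom_r, mul_one, mul_one] at h1
      rw [affineHom_sr, affineHom_sr, mul_zero, mul_zero, add_zero, add_zero] at h2
      injection h1 with h1
      injection h2 with h2
      exact Prod.ext h2 (Units.ext h1)
    · intro a
      obtain ⟨i, j, hij⟩ := exists_eq_affineHom hodd (f := a.toMonoidHom) a.injective
      have hi : i ≠ 0 := by
        rintro rfl
        have h1 : a (r 1) = affineHom 0 j (r 1) := DFunLike.congr_fun hij (r 1)
        rw [affineHom_r, zero_mul, r_zero, map_eq_one_iff a a.injective] at h1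
        exact r_one_ne_one h1
      exact ⟨(j, Units.mk0 i hi), MulEquiv.ext fun x => (DFunLike.congr_fun hij x).symm⟩
  rw [← Nat.card_congr (Equiv.ofBijective F hF), Nat.card_prod, Nat.card_zmod,
    Nat.card_eq_fintype_card, ZMod.card_units]

theorem card_injective_dihedral [Fact p.Prime] (hodd : Odd p) {G : Type*} [Group G] [Finite G] :
    Nat.card {f : DihedralGroup p →* G // Function.Injective f} +
      Nat.card (DihedralHom p true G) = Nat.card (DihedralGroup p →* G) := by
  have : Finite (DihedralGroup p →* G) := Finite.of_injective _ DFunLike.coe_injective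
  classical
  have e := Nat.card_congr (Equiv.sumCompl fun f : DihedralGroup p →* G => f (r 1) ≠ 1)
  rw [Nat.card_sum] at e
  rw [← e]
  congr 1
  · exact Nat.card_congr (Equiv.subtypeEquivRight fun f => dihedral_injective_iff hodd f)
  · exact Nat.card_congr (Equiv.subtypeEquivRight fun f => by simp)

theorem card_dihedralHom_false {G : Type*} [Group G] :
    Nat.card (DihedralHom p false G) = Nat.card (DihedralGroup p →* G) :=
  Nat.card_congr (Equiv.subtypeUnivEquiv fun f h => by cases h)

/-- Counting homomorphisms from, and subgroups isomorphic to, the dihedral group in the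
centralizer of a free action. -/
theorem card_hom_and_card_subgroups [Fact p.Prime] (hodd : Odd p) {A X : Type*} [Group A]
    [Finite A] (hA : ∀ a : A, a * a = 1) {τ : ℕ} (hcard : Nat.card A = τ) (hτ : 2 * τ = 2 ^ τ)
    [Finite X] {ρ : A →* Equiv.Perm X} (hρ : IsFreeAction ρ) {n : ℕ}
    (hn : Nat.card X = n * Nat.card A) {W : Type*} [Group W] [Finite W]
    (e : W ≃* Subgroup.centralizer (Set.range ρ)) :
    (Nat.card (DihedralGroup p →* W) : ℚ) = ∑ k ∈ Finset.Icc 0 (n / p),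
      ∑ l ∈ Finset.Icc 0 (k / 2), ∑ m ∈ Finset.Icc 0 ((n - k * p) / 2),
        (Nat.card W : ℚ) / denom p n τ k l m ∧
    (Nat.card {H : Subgroup W // Nonempty (H ≃* DihedralGroup p)} : ℚ) =
      (Nat.card W : ℚ) / ((p : ℚ) * ((p : ℚ) - 1)) *
        ∑ k ∈ Finset.Icc 1 (n / p), ∑ l ∈ Finset.Icc 0 (k / 2),
          ∑ m ∈ Finset.Icc 0 ((n - k * p) / 2), 1 / denom p n τ k l m := by
  subst hcard
  have h1 := card_dihedralHom_eq_sum hodd hA hτ hρ hn e false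
  have h2 := card_dihedralHom_eq_sum hodd hA hτ hρ hn e true
  rw [card_dihedralHom_false] at h1
  simp only [Bool.false_eq_true, if_false, if_true, one_pow, one_mul] at h1 h2
  refine ⟨?_, ?_⟩
  · rw [h1]
    simp only [Finset.mul_sum, mul_one_div]
  · have h3 := card_injective_dihedral hodd (G := W)
    rw [← card_subgroups_mul_card_aut, card_dihedral_aut hodd] at h3
    have hp := (Fact.out : p.Prime).two_le
    have hp1 : ((p : ℚ) - 1) ≠ 0 := by
      have : (2 : ℚ) ≤ p := by exact_mod_cast hp
      linarith
    have hp0 : (p : ℚ) ≠ 0 := by positivity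
    have h4 : (Nat.card {H : Subgroup W // Nonempty (H ≃* DihedralGroup p)} : ℚ) *
        (p * (p - 1)) + Nat.card (DihedralHom p true W) = Nat.card (DihedralGroup p →* W) := by
      rw [← h3]
      push_cast [Nat.cast_sub (show 1 ≤ p by omega)]
      ring
    have hIcc : Finset.Icc 0 (n / p) = insert 0 (Finset.Icc 1 (n / p)) := by
      ext k
      have := Nat.zero_le (n / p)
      simp only [Finset.mem_Icc, Finset.mem_insert]
      generalize n / p = N at *
      omega
    have hnot : 0 ∉ Finset.Icc 1 (n / p) := by simp
    rw [hIcc, Finset.sum_insert hnot] at h1 h2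
    -- For homomorphisms killing the rotations the weight is `0 ^ k`, so only `k = 0` survives, with
    -- `0 ^ 0 = 1`.
    rw [Finset.sum_eq_zero (s := Finset.Icc 1 (n / p)) fun k hk => by
      rw [zero_pow (by have := Finset.mem_Icc.1 hk; omega), zero_mul], pow_zero, one_mul,
      add_zero] at h2
    rw [h1, h2, mul_add, add_comm, add_right_inj] at h4
    rw [div_mul_eq_mul_div, ← h4]
    field_simp

end SubgroupCounting

theorem theorem2 (p : ℕ) (hp : p.Prime) (hodd : Odd p) (n : ℕ) :
    -- the number of homomorphisms `I_2(p) → C_n` (here `τ = 2`)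
    ((Nat.card (DihedralGroup p →* symmetryGroupCube n) : ℚ) =
      ∑ k ∈ Finset.Icc 0 (n / p), ∑ l ∈ Finset.Icc 0 (k / 2),
        ∑ m ∈ Finset.Icc 0 ((n - k * p) / 2),
          (Nat.card (symmetryGroupCube n) : ℚ) / denom p n 2 k l m) ∧
    -- the number of homomorphisms `I_2(p) → S_n` (here `τ = 1`)
    ((Nat.card (DihedralGroup p →* Equiv.Perm (Fin n)) : ℚ) =
      ∑ k ∈ Finset.Icc 0 (n / p), ∑ l ∈ Finset.Icc 0 (k / 2),
        ∑ m ∈ Finset.Icc 0 ((n - k * p) / 2),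
          (Nat.card (Equiv.Perm (Fin n)) : ℚ) / denom p n 1 k l m) ∧
    -- if `p ≤ n`, the number of subgroups isomorphic to `I_2(p)` in `C_n` and in `S_n`
    (p ≤ n →
      ((Nat.card {H : Subgroup (symmetryGroupCube n) // Nonempty (H ≃* DihedralGroup p)} : ℚ) =
        (Nat.card (symmetryGroupCube n) : ℚ) / ((p : ℚ) * ((p : ℚ) - 1)) *
          ∑ k ∈ Finset.Icc 1 (n / p), ∑ l ∈ Finset.Icc 0 (k / 2),
            ∑ m ∈ Finset.Icc 0 ((n - k * p) / 2), 1 / denom p n 2 k l m) ∧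
      ((Nat.card {H : Subgroup (Equiv.Perm (Fin n)) // Nonempty (H ≃* DihedralGroup p)} : ℚ) =
        (Nat.card (Equiv.Perm (Fin n)) : ℚ) / ((p : ℚ) * ((p : ℚ) - 1)) *
          ∑ k ∈ Finset.Icc 1 (n / p), ∑ l ∈ Finset.Icc 0 (k / 2),
            ∑ m ∈ Finset.Icc 0 ((n - k * p) / 2), 1 / denom p n 1 k l m)) := by
  have : Fact p.Prime := ⟨hp⟩
  obtain ⟨hC, hC'⟩ := card_hom_and_card_subgroups (p := p) hodd (A := ℤˣ) (τ := 2)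
    Int.units_mul_self (by simp) (by norm_num) (isFreeAction_signAction n) (n := n) (by simp)
    (symmetryGroupCubeEquiv n)
  -- The action of the trivial group is free, and its centralizer is the full symmetric group.
  obtain ⟨hS, hS'⟩ := card_hom_and_card_subgroups (p := p) hodd (A := Unit) (τ := 1)
    (fun _ => rfl) (by simp) (by norm_num) (ρ := (1 : Unit →* Equiv.Perm (Fin n)))
    (fun _ _ _ => rfl) (n := n) (by simp) (permEquivCentralizer (Fin n))
  exact ⟨hC, hS, fun _ => ⟨hC', hS'⟩⟩
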